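/- Let $k,l$ be non-zero coprime integers, $m=-k-l$, and suppose that $\{k,l,m\}$ is neither $\{1,1,-2\}$ nor $\{1,-1,0\}$ (as multisets). Let $W_{k,l}=SU(3)/S^1_{k,l}$ be the Aloff–Wallach space, where $S^1_{k,l}=\{\mathrm{diag}(e^{ik\theta},e^{il\theta},e^{im\theta}):\theta\in\mathbb R\}$. Put $s=\sqrt{(k^2+l^2+m^2)/6}$ and let $e^0,\dots,e^7$ be the left-invariant 1-forms on $SU(3)$ for which the Maurer–Cartan form is $$\frac1{\sqrt2}\begin{pmatrix} i\big(\tfrac{k}{\sqrt3 s}e^0+\tfrac{l-m}{3s}e^4\big)& e^1+ie^5&-e^3+ie^7\\ -e^1+ie^5& i\big(\tfrac{l}{\sqrt3 s}e^0+\tfrac{m-k}{3s}e^4\big)&e^2+ie^6\\ e^3+ie^7&-e^2+ie^6& i\big(\tfrac{m}{\sqrt3 s}e^0+\tfrac{k-l}{3s}e^4\big)\end{pmatrix}.$$ For non-zero real constants $A,B,C,D$ let $$\varphi_W=ABC(e^{123}-e^{167}+e^{257}-e^{356})-D(A^2e^{15}+B^2e^{26}+C^2e^{37})\wedge e^4,$$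 a $G_2$-structure on $W_{k,l}$ whose metric $g$ has orthonormal coframe $Ae^1,Be^2,Ce^3,De^4,Ae^5,Be^6,Ce^7$. Assume that $\varphi_W$ is nearly parallel, i.e. $d\varphi_W=\tau_0\star\varphi_W$ for some real $\tau_0\neq0$, where $\star$ is the Hodge star of the metric and orientation determined by $\varphi_W$. For $j=1,2,3$ let $\pi_j:W_{k,l}\to\mathbb{CP}^2$ send the coset of $g\in SU(3)$ to the complex line spanned by the $j$-th column of $g$; $\pi_3=\pi_{k,l}$ is the canonical fibration $SU(3)/S^1_{k,l}\to SU(3)/U(2)\cong\mathbb{CP}^2$. 1. Every fibre of $\pi_{k,l}$ is an embedded 3-dimensional submanifold of $W_{k,l}$ which is minimal for $g$ and associative, i.e. (for a suitable orientation) $\varphi_W$ restricts to its Riemannian volume form. 2. For each of $j=1,2,3$ the fibres of $\pi_j$ form a smooth family, parametrised by the 4-manifold $\mathbb{CP}^2$, of pairwise disjoint embedded minimal associative 3-folds, all diffeomorphic to the spherical space form $S^3/\mathbb Z_p$ (with $\mathbb Z_p$ acting on $S^3\subset\mathbb C^2$ by multiplication by $p$-th roots of unity), where $p=|k|,|l|,|k+l|$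 for $j=1,2,3$ respectively. The three families are different: no fibre of $\pi_i$ is a fibre of $\pi_j$ for $i\ne j$. If moreover $|k|,|l|,|k+l|$ are pairwise distinct, then no fibre of $\pi_i$ is even homeomorphic to a fibre of $\pi_j$ for $i\neq j$. -/

import Mathlib

open scoped Manifold ContDiff LinearAlgebra.Projectivization ComplexConjugate

noncomputable section

namespace AloffWallach

/-! ### Euclidean model spaces -/

abbrev E3 := EuclideanSpace ℝ (Fin 3)
abbrev E4 := EuclideanSpace ℝ (Fin 4)
abbrev E7 := EuclideanSpace ℝ (Fin 7)

/-- The unit sphere `S³ ⊂ ℝ⁴ = ℂ²`, with Mathlib's smooth structure. -/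
abbrev S3 := Metric.sphere (0 : EuclideanSpace ℝ (Fin (3 + 1))) 1

/-! ### Linear algebra of `G₂`-forms on a 7-dimensional space -/

section LinearAlgebra

variable {V : Type*} [AddCommGroup V] [Module ℝ V] [TopologicalSpace V]

/-- The determinant as a continuous alternating form on `ℝᵖ`. -/
def detForm (p : ℕ) : (Fin p → ℝ) [⋀^Fin p]→L[ℝ] ℝ :=
  { (Matrix.detRowAlternating : (Fin p → ℝ) [⋀^Fin p]→ₗ[ℝ] ℝ) with
    cont := by
      change Continuous fun M : Matrix (Fin p) (Fin p) ℝ => M.det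
      exact continuous_id.matrix_det }

/-- The wedge product `α₀ ∧ ⋯ ∧ α_{p-1}` of 1-forms: `(v₀, …) ↦ det (αⱼ(vᵢ))`. -/
def wedge {p : ℕ} (α : Fin p → V →L[ℝ] ℝ) : V [⋀^Fin p]→L[ℝ] ℝ :=
  (detForm p).compContinuousLinearMap (ContinuousLinearMap.pi α)

theorem wedge_apply {p : ℕ} (α : Fin p → V →L[ℝ] ℝ) (v : Fin p → V) :
    wedge α v = (Matrix.of fun i j => α j (v i)).det := rfl

/-- The model `G₂` 3-form of a coframe `η¹, …, η⁷`,
`η¹²⁷ + η³⁴⁷ + η⁵⁶⁷ + η¹³⁵ - η¹⁴⁶ - η²³⁶ - η²⁴⁵`.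
A `G₂`-structure is a 3-form which has this expression in some coframe `η` near each point.
Since the stabiliser `G₂` of the model form lies in `SO(7)`, the Riemannian metric
`∑ ηⁱ ⊗ ηⁱ` and the volume form `η¹²³⁴⁵⁶⁷` are determined by the 3-form. -/
def g2Form (η : Fin 7 → V →L[ℝ] ℝ) : V [⋀^Fin 3]→L[ℝ] ℝ :=
  wedge ![η 0, η 1, η 6] + wedge ![η 2, η 3, η 6] + wedge ![η 4, η 5, η 6]
    + wedge ![η 0, η 2, η 4] - wedge ![η 0, η 3, η 5] - wedge ![η 1, η 2, η 5]
    - wedge ![η 1, η 3, η 4]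

/-- The inner product for which the coframe `η` is orthonormal. -/
def coframeInner (η : Fin 7 → V →L[ℝ] ℝ) (u v : V) : ℝ := ∑ i, η i u * η i v

/-- The Hodge star of a 3-form `α`, evaluated on four vectors, for the metric with orthonormal
coframe `η`, volume form `η¹ ∧ ⋯ ∧ η⁷`, and `E` the frame dual to `η`:
`(⋆α)(v₀, …, v₃) = (1/3!) ∑ α(Eᵢ, Eⱼ, Eₖ) vol(Eᵢ, Eⱼ, Eₖ, v₀, …, v₃)`,
so that `⋆η¹²³ = η⁴⁵⁶⁷`. -/
def hodgeStar (η : Fin 7 → V →L[ℝ] ℝ) (E : Fin 7 → V) (α : V [⋀^Fin 3]→L[ℝ] ℝ)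
    (v : Fin 4 → V) : ℝ :=
  (1 / 6) * ∑ i, ∑ j, ∑ k,
    α ![E i, E j, E k] * wedge η ![E i, E j, E k, v 0, v 1, v 2, v 3]

end LinearAlgebra

/-! ### The spaces `W_{k,l}` -/

/-- The group `SU(3)`. -/
abbrev SU3 := Matrix.specialUnitaryGroup (Fin 3) ℂ

/-- The weights `(k, l, m)` with `m = -k - l`. -/
def weight (k l : ℤ) : Fin 3 → ℤ := ![k, l, -k - l]

/-- The circle subgroup `S¹_{k,l} = {diag(e^{ikθ}, e^{ilθ}, e^{imθ})}` of `SU(3)`. -/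
def circle (k l : ℤ) : Subgroup SU3 where
  carrier := {h | ∃ θ : ℝ, (h : Matrix (Fin 3) (Fin 3) ℂ) =
    Matrix.diagonal fun j => Complex.exp (Complex.I * (weight k l j : ℂ) * (θ : ℂ))}
  one_mem' := ⟨0, by simp⟩
  mul_mem' := by
    rintro a b ⟨s, hs⟩ ⟨t, ht⟩
    refine ⟨s + t, ?_⟩
    rw [Submonoid.coe_mul, hs, ht, Matrix.diagonal_mul_diagonal]
    congr 1
    funext j
    rw [← Complex.exp_add]
    congr 1
    push_cast
    ring
  inv_mem' := by
    rintro a ⟨s, hs⟩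
    refine ⟨-s, ?_⟩
    change star (a : Matrix (Fin 3) (Fin 3) ℂ) = _
    rw [hs, Matrix.star_eq_conjTranspose, Matrix.diagonal_conjTranspose]
    congr 1
    funext j
    simp [← Complex.exp_conj]

/-- The Aloff–Wallach space `W_{k,l} = SU(3) / S¹_{k,l}`, with the quotient topology. Its smooth
structure is the one for which `SU(3) → W_{k,l}` is a submersion (a principal circle bundle). -/
abbrev W (k l : ℤ) := SU3 ⧸ circle k l

/-- The `j`-th column of a special unitary matrix is nonzero. -/
theorem col_ne_zero (g : SU3) (j : Fin 3) :
    (fun i => (g : Matrix (Fin 3) (Fin 3) ℂ) i j) ≠ 0 := by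
  intro h
  have hdet : (g : Matrix (Fin 3) (Fin 3) ℂ).det = 1 :=
    (Matrix.mem_specialUnitaryGroup_iff.1 g.2).2
  rw [Matrix.det_eq_zero_of_column_eq_zero j (fun i => congrFun h i)] at hdet
  exact zero_ne_one hdet

/-- The complex projective plane. -/
abbrev CP2 := ℙ ℂ (Fin 3 → ℂ)

/-- The projection `W_{k,l} → ℂP²` taking the coset of `g` to the line spanned by the `j`-th column
of `g`, i.e. the map `SU(3)/S¹_{k,l} → SU(3)/U(2) ≅ ℂP²` for the subgroup `U(2)` of `SU(3)`
stabilising the `j`-th coordinate line. For `j = 2` (the last column) the matrices in `U(2)` are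
block-diagonal with a 2×2 block followed by a 1×1 block, and this is the canonical fibration
`π_{k,l}`. -/
def proj (k l : ℤ) (j : Fin 3) : W k l → CP2 :=
  Quotient.lift (s := QuotientGroup.leftRel (circle k l))
    (fun g : SU3 => Projectivization.mk ℂ
      (fun i => (g : Matrix (Fin 3) (Fin 3) ℂ) i j) (col_ne_zero g j)) (by
    intro a b hab
    obtain ⟨θ, hθ⟩ := QuotientGroup.leftRel_apply.1 hab
    rw [Projectivization.mk_eq_mk_iff']
    refine ⟨Complex.exp (-(Complex.I * (weight k l j : ℂ) * (θ : ℂ))), ?_⟩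
    have hb : (b : Matrix (Fin 3) (Fin 3) ℂ) = (a : Matrix (Fin 3) (Fin 3) ℂ) *
        Matrix.diagonal fun j => Complex.exp (Complex.I * (weight k l j : ℂ) * (θ : ℂ)) := by
      rw [← hθ, ← Submonoid.coe_mul, mul_inv_cancel_left]
    funext i
    simp only [Pi.smul_apply, smul_eq_mul, hb, Matrix.mul_diagonal]
    rw [mul_comm, mul_assoc, ← Complex.exp_add, add_neg_cancel, Complex.exp_zero, mul_one])

/-- The fibre of the `j`-th projection over `x`. -/
def fibre (k l : ℤ) (j : Fin 3) (x : CP2) : Set (W k l) := proj k l j ⁻¹' {x}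

/-! ### The left-invariant coframe and the 3-forms `φ_W` -/

section Forms

variable {V : Type*} [AddCommGroup V] [Module ℝ V] [TopologicalSpace V]

/-- The value `g⁻¹ dg` of the Maurer–Cartan form, entry by entry, when the differential at a point
of an `SU(3)`-valued map with value `g` there is `dg`. -/
def maurerCartan (g : SU3) (dg : Fin 3 → Fin 3 → V →L[ℝ] ℂ) : Fin 3 → Fin 3 → V →L[ℝ] ℂ :=
  fun i j => ∑ r, conj ((g : Matrix (Fin 3) (Fin 3) ℂ) r i) • dg r j

/-- `s = √((k² + l² + m²)/6)`. -/
def sNorm (k l : ℤ) : ℝ := √((∑ j, (weight k l j : ℝ) ^ 2) / 6)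

/-- The integers `(l - m, m - k, k - l)`. -/
def coweight (k l : ℤ) : Fin 3 → ℤ :=
  ![weight k l 1 - weight k l 2, weight k l 2 - weight k l 0, weight k l 0 - weight k l 1]

/-- The 1-forms `e¹, …, e⁷` (in this order, indexed from `0`), as components of a Maurer–Cartan
form `Ω`; see `maurerCartan_eq`. -/
def coframe (k l : ℤ) (Ω : Fin 3 → Fin 3 → V →L[ℝ] ℂ) : Fin 7 → V →L[ℝ] ℝ :=
  ![√2 • Complex.reCLM.comp (Ω 0 1), √2 • Complex.reCLM.comp (Ω 1 2),
    √2 • Complex.reCLM.comp (Ω 2 0),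
    (√2 / (6 * sNorm k l)) • ∑ j, (coweight k l j : ℝ) • Complex.imCLM.comp (Ω j j),
    √2 • Complex.imCLM.comp (Ω 0 1), √2 • Complex.imCLM.comp (Ω 1 2),
    √2 • Complex.imCLM.comp (Ω 2 0)]

/-- The remaining 1-form `e⁰`, dual to the circle direction. -/
def coframeZero (k l : ℤ) (Ω : Fin 3 → Fin 3 → V →L[ℝ] ℂ) : V →L[ℝ] ℝ :=
  (√2 * √3 / (6 * sNorm k l)) • ∑ j, (weight k l j : ℝ) • Complex.imCLM.comp (Ω j j)

/-- On `𝔰𝔲(3)`-valued 1-forms `Ω`, the `eⁱ` are the components in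
`Ω = (1/√2) (i((k/√3s)e⁰ + ((l-m)/3s)e⁴), e¹ + ie⁵, -e³ + ie⁷; …)`. -/
theorem maurerCartan_eq (k l : ℤ) (hk : k ≠ 0) (Ω : Fin 3 → Fin 3 → V →L[ℝ] ℂ) (v : V)
    (hskew : ∀ i j, Ω i j v = -conj (Ω j i v)) (htr : ∑ i, Ω i i v = 0) :
    let s : ℝ := sNorm k l
    let m : ℤ := -k - l
    let e₀ : ℝ := coframeZero k l Ω v
    let e : Fin 7 → ℝ := fun a => coframe k l Ω a v
    (Matrix.of fun i j => Ω i j v) = ((1 / √2 : ℝ) : ℂ) •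
      !![Complex.I * ((k / (√3 * s) * e₀ + (l - m) / (3 * s) * e 3 : ℝ) : ℂ),
          e 0 + Complex.I * e 4, -e 2 + Complex.I * e 6;
        -e 0 + Complex.I * e 4,
          Complex.I * ((l / (√3 * s) * e₀ + (m - k) / (3 * s) * e 3 : ℝ) : ℂ),
          e 1 + Complex.I * e 5;
        e 2 + Complex.I * e 6, -e 1 + Complex.I * e 5,
          Complex.I * ((m / (√3 * s) * e₀ + (k - l) / (3 * s) * e 3 : ℝ) : ℂ)] := by
  intro s m e₀ e
  have h2 : √2 * √2 = (2 : ℝ) := Real.mul_self_sqrt (by norm_num)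
  have h2' : √2 ≠ 0 := by positivity
  have h3' : √3 ≠ 0 := by positivity
  have hk' : (0 : ℝ) < (k : ℝ) ^ 2 := by positivity
  have hs2 : s ^ 2 = ((k : ℝ) ^ 2 + (l : ℝ) ^ 2 + (-k - l : ℝ) ^ 2) / 6 := by
    simp only [s, sNorm]
    rw [Real.sq_sqrt (by positivity)]
    simp [weight, Fin.sum_univ_three]
  have hs : s ≠ 0 := by
    intro h
    rw [h] at hs2
    nlinarith [sq_nonneg (l : ℝ), sq_nonneg (-k - l : ℝ)]
  have him : (Ω 0 0 v).im + (Ω 1 1 v).im + (Ω 2 2 v).im = 0 := by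
    simpa [Fin.sum_univ_three] using congrArg Complex.im htr
  have hre : ∀ i, (Ω i i v).re = 0 := fun i => by
    have := congrArg Complex.re (hskew i i)
    simp at this
    linarith
  have he₀ : e₀ = (√2 * √3 / (6 * s)) *
      (k * (Ω 0 0 v).im + l * (Ω 1 1 v).im + (-k - l) * (Ω 2 2 v).im) := by
    simp [e₀, coframeZero, weight, Fin.sum_univ_three, s]
    ring
  have he3 : e 3 = (√2 / (6 * s)) * ((l - (-k - l)) * (Ω 0 0 v).im
      + ((-k - l) - k) * (Ω 1 1 v).im + (k - l) * (Ω 2 2 v).im) := by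
    simp [e, coframe, coweight, weight, Fin.sum_univ_three, s]
    ring
  have hm : (m : ℝ) = -k - l := by simp [m]
  have hd2 : (Ω 2 2 v).im = -(Ω 0 0 v).im - (Ω 1 1 v).im := by linarith
  have d0 : (1 / √2) * (k / (√3 * s) * e₀ + (l - m) / (3 * s) * e 3) = (Ω 0 0 v).im := by
    rw [he₀, he3, hm, hd2]
    field_simp
    rw [hs2]
    ring
  have d1 : (1 / √2) * (l / (√3 * s) * e₀ + (m - k) / (3 * s) * e 3) = (Ω 1 1 v).im := by
    rw [he₀, he3, hm, hd2]
    field_simp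
    rw [hs2]
    ring
  have d2 : (1 / √2) * (m / (√3 * s) * e₀ + (k - l) / (3 * s) * e 3) = (Ω 2 2 v).im := by
    rw [he₀, he3, hm, hd2]
    field_simp
    rw [hs2]
    ring
  have g0 : e 0 = √2 * (Ω 0 1 v).re := by simp [e, coframe]
  have g1 : e 1 = √2 * (Ω 1 2 v).re := by simp [e, coframe]
  have g2 : e 2 = √2 * (Ω 2 0 v).re := by simp [e, coframe]
  have g4 : e 4 = √2 * (Ω 0 1 v).im := by simp [e, coframe]
  have g5 : e 5 = √2 * (Ω 1 2 v).im := by simp [e, coframe]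
  have g6 : e 6 = √2 * (Ω 2 0 v).im := by simp [e, coframe]
  clear_value e e₀
  generalize k / (√3 * s) * e₀ + (l - m) / (3 * s) * e 3 = a₀ at d0 ⊢
  generalize l / (√3 * s) * e₀ + (m - k) / (3 * s) * e 3 = a₁ at d1 ⊢
  generalize m / (√3 * s) * e₀ + (k - l) / (3 * s) * e 3 = a₂ at d2 ⊢
  ext i j
  rw [Matrix.smul_apply, smul_eq_mul]
  apply Complex.ext
  · rw [Complex.re_ofReal_mul]
    fin_cases i <;> fin_cases j <;>
      simp [hre, g0, g1, g2, h2', hskew 1 0, hskew 2 1, hskew 0 2]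
  · rw [Complex.im_ofReal_mul]
    fin_cases i <;> fin_cases j <;>
      simp [-one_div, d0, d1, d2, g4, g5, g6, hskew 1 0, hskew 2 1, hskew 0 2] <;>
      field_simp

/-- The coframe `Ae¹, Be², Ce³, De⁴, Ae⁵, Be⁶, Ce⁷`. -/
def scaledCoframe (k l : ℤ) (A B C D : ℝ) (Ω : Fin 3 → Fin 3 → V →L[ℝ] ℂ) :
    Fin 7 → V →L[ℝ] ℝ :=
  fun a => (![A, B, C, D, A, B, C] : Fin 7 → ℝ) a • coframe k l Ω a

/-- The 3-form `φ_W = ABC (e¹²³ - e¹⁶⁷ + e²⁵⁷ - e³⁵⁶) - D (A² e¹⁵ + B² e²⁶ + C² e³⁷) ∧ e⁴`. -/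
def phiW (k l : ℤ) (A B C D : ℝ) (Ω : Fin 3 → Fin 3 → V →L[ℝ] ℂ) : V [⋀^Fin 3]→L[ℝ] ℝ :=
  let e := coframe k l Ω
  (A * B * C) • (wedge ![e 0, e 1, e 2] - wedge ![e 0, e 5, e 6] + wedge ![e 1, e 4, e 6]
      - wedge ![e 2, e 4, e 5])
    - D • (A ^ 2 • wedge ![e 0, e 4, e 3] + B ^ 2 • wedge ![e 1, e 5, e 3]
      + C ^ 2 • wedge ![e 2, e 6, e 3])

/-- The coframe `Ae¹, Ae⁵, Be², Be⁶, Ce³, Ce⁷, -De⁴`, in which `φ_W` is the model `G₂`-form, see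
`phiW_eq_g2Form`. Hence it is an oriented orthonormal coframe for the metric and orientation
determined by `φ_W`. -/
def adaptedCoframe (k l : ℤ) (A B C D : ℝ) (Ω : Fin 3 → Fin 3 → V →L[ℝ] ℂ) :
    Fin 7 → V →L[ℝ] ℝ :=
  let ε := scaledCoframe k l A B C D Ω
  ![ε 0, ε 4, ε 1, ε 5, ε 2, ε 6, -ε 3]

theorem phiW_eq_g2Form (k l : ℤ) (A B C D : ℝ) (Ω : Fin 3 → Fin 3 → V →L[ℝ] ℂ) :
    phiW k l A B C D Ω = g2Form (adaptedCoframe k l A B C D Ω) := by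
  ext v
  simp [phiW, g2Form, adaptedCoframe, scaledCoframe, wedge_apply, Matrix.det_fin_three]
  ring

/-- The metric determined by `φ_W` has orthonormal coframe `Ae¹, Be², Ce³, De⁴, Ae⁵, Be⁶, Ce⁷`. -/
theorem coframeInner_adaptedCoframe (k l : ℤ) (A B C D : ℝ) (Ω : Fin 3 → Fin 3 → V →L[ℝ] ℂ)
    (u v : V) : coframeInner (adaptedCoframe k l A B C D Ω) u v =
      coframeInner (scaledCoframe k l A B C D Ω) u v := by
  simp [coframeInner, adaptedCoframe, Fin.sum_univ_succ]
  ring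

end Forms

/-! ### Local coordinates on `W_{k,l}` -/

/-- The pull-back of the Maurer–Cartan form by `ψ : E → SU(3)`. -/
def pullMC {E : Type*} [NormedAddCommGroup E] [NormedSpace ℝ E] (ψ : E → SU3) (x : E) :
    Fin 3 → Fin 3 → E →L[ℝ] ℂ :=
  maurerCartan (ψ x) fun i j => fderiv ℝ (fun y => (ψ y : Matrix (Fin 3) (Fin 3) ℂ) i j) x

/-- `x ↦ [ψ x]`, `x ∈ U`, is a local parametrisation of `W_{k,l}` (the inverse of a coordinate
chart), given by a smooth local lift `ψ` to `SU(3)`. Locally every smooth map to `W_{k,l}` has such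
a lift. The vectors of `𝔰𝔲(3)` on which `e¹, …, e⁷` all vanish are those tangent to the circle, so
the third condition says that the differential of `x ↦ [ψ x]` is injective, hence bijective; with
the injectivity condition, the map is a diffeomorphism from `U` onto an open subset of `W_{k,l}`. -/
structure IsChart (k l : ℤ) (ψ : E7 → SU3) (U : Set E7) : Prop where
  isOpen : IsOpen U
  smooth : ∀ i j, ContDiffOn ℝ ∞ (fun x => (ψ x : Matrix (Fin 3) (Fin 3) ℂ) i j) U
  immersive : ∀ x ∈ U, ∀ v : E7, (∀ a, coframe k l (pullMC ψ x) a v = 0) → v = 0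
  injOn : Set.InjOn (fun x => (ψ x : W k l)) U

/-- `φ_W` in the coordinates `ψ`. -/
def phiChart (k l : ℤ) (A B C D : ℝ) (ψ : E7 → SU3) (x : E7) : E7 [⋀^Fin 3]→L[ℝ] ℝ :=
  phiW k l A B C D (pullMC ψ x)

/-- The Riemannian metric determined by `φ_W` in the coordinates `ψ`. -/
def metricChart (k l : ℤ) (A B C D : ℝ) (ψ : E7 → SU3) (x u v : E7) : ℝ :=
  coframeInner (adaptedCoframe k l A B C D (pullMC ψ x)) u v

/-- The `G₂`-structure `φ_W` on `W_{k,l}` is nearly parallel: there is a constant `τ₀ ≠ 0` with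
`dφ_W = τ₀ ⋆φ_W`, in all local coordinates. -/
def IsNearlyParallel (k l : ℤ) (A B C D : ℝ) : Prop :=
  ∃ τ : ℝ, τ ≠ 0 ∧ ∀ (ψ : E7 → SU3) (U : Set E7), IsChart k l ψ U → ∀ x ∈ U,
    ∀ E : Fin 7 → E7,
      (∀ i j, adaptedCoframe k l A B C D (pullMC ψ x) i (E j) = if i = j then 1 else 0) →
      ∀ v : Fin 4 → E7, extDeriv (phiChart k l A B C D ψ) x v =
        τ * hodgeStar (adaptedCoframe k l A B C D (pullMC ψ x)) E (phiChart k l A B C D ψ x) v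

/-! ### Submanifolds -/

/-- `Y` is an embedded 3-dimensional submanifold of `W_{k,l}`: near each of its points there are
coordinates in which it is the slice `ℝ³ × 0 ⊂ ℝ⁷`. -/
def IsEmbeddedThreefold (k l : ℤ) (Y : Set (W k l)) : Prop :=
  ∀ y ∈ Y, ∃ (ψ : E7 → SU3) (U : Set E7) (x : E7), IsChart k l ψ U ∧ x ∈ U ∧
    (ψ x : W k l) = y ∧
    ∀ z ∈ U, ((ψ z : W k l) ∈ Y ↔ z 3 = 0 ∧ z 4 = 0 ∧ z 5 = 0 ∧ z 6 = 0)

/-- In the coordinates `ψ` on `U`, `u : O → U` is a smooth map from an open set `O ⊂ ℝ³` into `Y`;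
where `du` is injective, it is a local parametrisation of the 3-dimensional submanifold `Y`. -/
structure IsParam (k l : ℤ) (Y : Set (W k l)) (ψ : E7 → SU3) (U : Set E7)
    (u : E3 → E7) (O : Set E3) : Prop where
  isChart : IsChart k l ψ U
  isOpen : IsOpen O
  smooth : ContDiffOn ℝ ∞ u O
  mapsTo : Set.MapsTo u O U
  mem : ∀ b ∈ O, (ψ (u b) : W k l) ∈ Y

/-- The vectors `du(t₀), du(t₁), du(t₂)` at `u b` are orthonormal for the inner product `g`
(so they are an orthonormal basis of the tangent space of the parametrised 3-fold). -/
def IsTangentFrame (g : E7 → E7 → ℝ) (u : E3 → E7) (b : E3) (t : Fin 3 → E3) : Prop :=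
  ∀ i j, g (fderiv ℝ u b (t i)) (fderiv ℝ u b (t j)) = if i = j then 1 else 0

/-- `φ_W` restricts to the volume form of `Y` for the orientation of `Y` it defines: it takes the
value `±1` on orthonormal bases of the tangent spaces of `Y`. -/
def IsAssociative (k l : ℤ) (A B C D : ℝ) (Y : Set (W k l)) : Prop :=
  ∀ (ψ : E7 → SU3) (U : Set E7) (u : E3 → E7) (O : Set E3), IsParam k l Y ψ U u O →
    ∀ b ∈ O, ∀ t : Fin 3 → E3, IsTangentFrame (metricChart k l A B C D ψ (u b)) u b t →
      |phiChart k l A B C D ψ (u b) (fun i => fderiv ℝ u b (t i))| = 1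

/-- The Christoffel symbols of the first kind of a metric `g` on an open subset of `ℝ⁷`:
`g(∇ᵤv, w) = ½ (∂ᵤ g(v, w) + ∂ᵥ g(u, w) - ∂_w g(u, v))` for constant `u, v, w`. -/
def christoffel (g : E7 → E7 → E7 → ℝ) (x u v w : E7) : ℝ :=
  (1 / 2) * (fderiv ℝ (fun y => g y v w) x u + fderiv ℝ (fun y => g y u w) x v
    - fderiv ℝ (fun y => g y u v) x w)

/-- `Y` is minimal for the metric determined by `φ_W`: its mean curvature vector, the trace of the
second fundamental form `II(t, t) = (∂ₜ∂ₜ u + Γ(∂ₜu, ∂ₜu))^⊥` over an orthonormal basis of the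
tangent space, vanishes, i.e. is orthogonal to every normal vector `n`. -/
def IsMinimal (k l : ℤ) (A B C D : ℝ) (Y : Set (W k l)) : Prop :=
  ∀ (ψ : E7 → SU3) (U : Set E7) (u : E3 → E7) (O : Set E3), IsParam k l Y ψ U u O →
    ∀ b ∈ O, ∀ t : Fin 3 → E3, IsTangentFrame (metricChart k l A B C D ψ (u b)) u b t →
      ∀ n : E7, (∀ i, metricChart k l A B C D ψ (u b) n (fderiv ℝ u b (t i)) = 0) →
        ∑ i, (metricChart k l A B C D ψ (u b) (fderiv ℝ (fderiv ℝ u) b (t i) (t i)) n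
          + christoffel (metricChart k l A B C D ψ) (u b)
              (fderiv ℝ u b (t i)) (fderiv ℝ u b (t i)) n) = 0

/-! ### Families of spherical space forms -/

/-- `x, y ∈ S³ ⊂ ℂ²` are in the same orbit of the group `ℤ_p` of `p`-th roots of unity, acting
(freely and isometrically) by scalar multiplication. The orbit space is `S³/ℤ_p`. -/
def SameOrbit (p : ℕ) (x y : S3) : Prop :=
  ∃ ζ : ℂ, ζ ^ p = 1 ∧
    (⟨y.1 0, y.1 1⟩ : ℂ) = ζ * ⟨x.1 0, x.1 1⟩ ∧ (⟨y.1 2, y.1 3⟩ : ℂ) = ζ * ⟨x.1 2, x.1 3⟩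

/-- `b ↦ [w b]`, `b ∈ O ⊂ ℝ⁴`, is a local parametrisation of `ℂP²`, with values the points `q b`:
it is smooth and injective, with injective differential (modulo the complex line `[w b]`). -/
structure IsCP2Chart (w : E4 → Fin 3 → ℂ) (q : E4 → CP2) (O : Set E4) : Prop where
  isOpen : IsOpen O
  smooth : ContDiffOn ℝ ∞ w O
  eq_mk : ∀ b ∈ O, ∃ h : w b ≠ 0, q b = Projectivization.mk ℂ (w b) h
  immersive : ∀ b ∈ O, ∀ v : E4, (∃ c : ℂ, fderiv ℝ w b v = c • w b) → v = 0
  injOn : Set.InjOn q O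

/-- The pull-back of the Maurer–Cartan form by `F : ℝ⁴ × S³ → SU(3)`. -/
def pullMCProd (F : E4 × S3 → SU3) (z : E4 × S3) :
    Fin 3 → Fin 3 → TangentSpace ((𝓘(ℝ, E4)).prod (𝓡 3)) z →L[ℝ] ℂ :=
  maurerCartan (F z) fun i j => mfderiv ((𝓘(ℝ, E4)).prod (𝓡 3)) 𝓘(ℝ, ℂ)
    (fun y => (F y : Matrix (Fin 3) (Fin 3) ℂ) i j) z

/-- The sets `Y x`, `x ∈ ℂP²`, are a smooth family of pairwise disjoint submanifolds of `W_{k,l}`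
diffeomorphic to `S³/ℤ_p`, parametrised by the 4-dimensional manifold `ℂP²`. Near each `x₀` there
are coordinates `b ∈ O ⊂ ℝ⁴` on `ℂP²`, and a smooth immersion `[F] : O × S³ → W_{k,l}` between
7-manifolds which induces an injective map on `O × (S³/ℤ_p)` and diffeomorphisms of
`{b} × (S³/ℤ_p)` to `Y (q b)`. (A smooth map of `O × S³` to `W_{k,l}` lifts to a smooth map `F` to
`SU(3)` if `O` is a small ball, since circle bundles over `O × S³` are then trivial.) -/
def IsSpaceFormFamily (k l : ℤ) (p : ℕ) (Y : CP2 → Set (W k l)) : Prop :=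
  (∀ x y : CP2, x ≠ y → Disjoint (Y x) (Y y)) ∧
  ∀ x₀ : CP2, ∃ (w : E4 → Fin 3 → ℂ) (q : E4 → CP2) (O : Set E4) (F : E4 × S3 → SU3),
    IsCP2Chart w q O ∧ x₀ ∈ q '' O ∧
    (∀ i j, ContMDiffOn ((𝓘(ℝ, E4)).prod (𝓡 3)) 𝓘(ℝ, ℂ) ∞
      (fun z => (F z : Matrix (Fin 3) (Fin 3) ℂ) i j) (O ×ˢ Set.univ)) ∧
    (∀ z ∈ O ×ˢ (Set.univ : Set S3), ∀ v : TangentSpace ((𝓘(ℝ, E4)).prod (𝓡 3)) z,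
      (∀ a, coframe k l (pullMCProd F z) a v = 0) → v = 0) ∧
    (∀ b ∈ O, ∀ b' ∈ O, ∀ x x' : S3,
      (F (b, x) : W k l) = (F (b', x') : W k l) ↔ b = b' ∧ SameOrbit p x x') ∧
    ∀ b ∈ O, Set.range (fun x : S3 => (F (b, x) : W k l)) = Y (q b)

end AloffWallach

end

/-! Let `w` be the triple of weights. The fibre of the `j`-th projection through `[g]` is
`g·U(2)/S¹`, with `U(2)` the stabiliser of the `j`-th coordinate line. Since `w j ≠ 0`, the circle
can be used to make the `j`-th diagonal entry of an element of `U(2)` equal to 1, so `SU(2) = S³`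
maps onto the fibre (`range_tube`). Two points of `S³` have the same image exactly when they differ
by a circle element with `exp(i w_j θ) = 1`. Such elements act on the first column, a vector of
`ℂ²`, by the scalars `exp(i w_{j+1} θ)`; because `w_j` and `w_{j+1}` are coprime, these are all the
`|w_j|`-th roots of unity (`tube_eq_iff`). Combined with a section of `SU(3) → ℂP²` over an affine
chart this gives an immersion of `ℝ⁴ × S³` (`tubeMatrix_immersive`). It exhibits the smooth family
and, with coordinates on a hemisphere of `S³`, also provides slice charts of the fibres.

Along a fibre the `j`-th column stays in one line, so the Maurer–Cartan form `Ω` has `Ω i j = Ω j i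
= 0` for `i ≠ j` (`pullMC_off_eq_zero`). Of the coframe only `e⁴` and the real and imaginary parts
of one entry `Ω α β` survive, where `α = j + 1` and `β = j + 2`. The only term of `φ_W` left is, up
to sign, the wedge of the three surviving scaled forms, which is the volume form: the fibre is
associative.

For minimality, the Koszul formula in a coframe reduces the second fundamental form `II(p, p)`,
paired with a normal `n`, to the sum of the terms `eᵃ(p) deᵃ(p, n)` weighted by the squared scale
factors. By the Maurer–Cartan equation `dΩ α β (p, n) = (Ω α α n - Ω β β n) Ω α β p`, an imaginary
multiple of `Ω α β p`, and `de⁴(p, n) = 0` (`sum_coframe_mul_d_eq_zero`). The real and imaginary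
parts carry the same scale factor, so the sum vanishes for each tangent `p`, and the fibres are even
totally geodesic.

A fibre of `π_i` contains two cosets whose `j`-th columns are orthogonal, so it is not a fibre of
`π_j`. Finally, a homeomorphism between two fibres lifts to a homeomorphism of their common simply
connected cover `S³`, matching the covering fibres; these have `|w_i|` and `|w_j|` points
(`card_eq_of_homeomorph`). -/

noncomputable section

namespace AloffWallach

/-! ### Explicit sections of `SU(3) → ℂP²` and of `U(2) → U(2)/S¹` -/

/-- The two complex coordinates of a vector of `ℝ⁴ = ℂ²`. -/
def cplx₁ (b : E4) : ℂ := ⟨b 0, b 1⟩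
def cplx₂ (b : E4) : ℂ := ⟨b 2, b 3⟩

theorem cplx_ext {b b' : E4} (h₁ : cplx₁ b = cplx₁ b') (h₂ : cplx₂ b = cplx₂ b') : b = b' := by
  simp only [cplx₁, cplx₂, Complex.mk.injEq] at h₁ h₂
  ext i
  fin_cases i
  exacts [h₁.1, h₁.2, h₂.1, h₂.2]

theorem cplx₁_add (b b' : E4) : cplx₁ (b + b') = cplx₁ b + cplx₁ b' := by
  apply Complex.ext <;> simp [cplx₁]

theorem cplx₂_add (b b' : E4) : cplx₂ (b + b') = cplx₂ b + cplx₂ b' := by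
  apply Complex.ext <;> simp [cplx₂]

theorem cplx₁_smul (t : ℝ) (b : E4) : cplx₁ (t • b) = t * cplx₁ b := by
  apply Complex.ext <;> simp [cplx₁]

theorem cplx₂_smul (t : ℝ) (b : E4) : cplx₂ (t • b) = t * cplx₂ b := by
  apply Complex.ext <;> simp [cplx₂]

@[simp] theorem cplx₁_zero : cplx₁ 0 = 0 := by apply Complex.ext <;> simp [cplx₁]
@[simp] theorem cplx₂_zero : cplx₂ 0 = 0 := by apply Complex.ext <;> simp [cplx₂]

theorem contDiff_cplx₁ : ContDiff ℝ ∞ cplx₁ := by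
  have : cplx₁ = fun b : E4 => ((b 0 : ℝ) : ℂ) + ((b 1 : ℝ) : ℂ) * Complex.I := by
    funext b; apply Complex.ext <;> simp [cplx₁]
  rw [this]
  have h : ContDiff ℝ ∞ (fun r : ℝ => (r : ℂ)) := Complex.ofRealCLM.contDiff
  exact (h.comp (by fun_prop)).add ((h.comp (by fun_prop)).mul contDiff_const)

theorem contDiff_cplx₂ : ContDiff ℝ ∞ cplx₂ := by
  have : cplx₂ = fun b : E4 => ((b 2 : ℝ) : ℂ) + ((b 3 : ℝ) : ℂ) * Complex.I := by
    funext b; apply Complex.ext <;> simp [cplx₂]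
  rw [this]
  have h : ContDiff ℝ ∞ (fun r : ℝ => (r : ℂ)) := Complex.ofRealCLM.contDiff
  exact (h.comp (by fun_prop)).add ((h.comp (by fun_prop)).mul contDiff_const)

theorem contDiff_conj : ContDiff ℝ ∞ (fun z : ℂ => conj z) := Complex.conjCLE.contDiff

theorem cplx_norm (b : E4) : cplx₁ b * conj (cplx₁ b) + cplx₂ b * conj (cplx₂ b) =
    ((‖b‖ ^ 2 : ℝ) : ℂ) := by
  rw [Complex.mul_conj, Complex.mul_conj, EuclideanSpace.norm_sq_eq, ← Complex.ofReal_add]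
  congr 1
  simp [Complex.normSq, cplx₁, cplx₂, Fin.sum_univ_four]
  ring

/-- The unitary matrix of determinant 1 with last column `(u₁, u₂, c)`. -/
def frameMatrix (u₁ u₂ c : ℂ) : Matrix (Fin 3) (Fin 3) ℂ :=
  !![1 - u₁ * conj u₁ * (1 + c)⁻¹, -(u₁ * conj u₂ * (1 + c)⁻¹), u₁;
    -(u₂ * conj u₁ * (1 + c)⁻¹), 1 - u₂ * conj u₂ * (1 + c)⁻¹, u₂;
    -conj u₁, -conj u₂, c]

/-- With `u = (u₁, u₂)`, the upper left block is `1 - u u* / (1 + c)`: the matrix fixes the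
complement of `u` in `ℂ²` and rotates the last basis vector to `(u, c)`. All identities reduce to
`|u|² + c² = 1`; positivity of `c` makes `1 + c` invertible. -/
theorem frameMatrix_mem (u₁ u₂ : ℂ) (c : ℝ) (hc : 0 < c)
    (h : u₁ * conj u₁ + u₂ * conj u₂ + c ^ 2 = 1) : frameMatrix u₁ u₂ c ∈
      Matrix.specialUnitaryGroup (Fin 3) ℂ := by
  have hc' : (1 + c : ℂ) ≠ 0 := by
    have : (1 + c : ℝ) ≠ 0 := by positivity
    exact_mod_cast this
  have hd : conj ((1 + c : ℂ)⁻¹) = (1 + c : ℂ)⁻¹ := by simp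
  have he : (1 + c : ℂ)⁻¹ * (1 + c) = 1 := inv_mul_cancel₀ hc'
  rw [Matrix.mem_specialUnitaryGroup_iff, Matrix.mem_unitaryGroup_iff']
  generalize hd' : (1 + c : ℂ)⁻¹ = d at *
  have hcc : conj (c : ℂ) = c := Complex.conj_ofReal c
  constructor
  · ext i j
    fin_cases i <;> fin_cases j <;>
      simp [frameMatrix, Matrix.mul_apply, Fin.sum_univ_three, Matrix.star_apply, hd, hd'] <;>
      grind
  · simp [frameMatrix, Matrix.det_fin_three, hd']
    grind

/-- `1/√(1 + |b|²)`. -/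
def invNorm (b : E4) : ℝ := (√(1 + ‖b‖ ^ 2))⁻¹

theorem invNorm_pos (b : E4) : 0 < invNorm b := by unfold invNorm; positivity

theorem invNorm_sq (b : E4) : invNorm b ^ 2 * (1 + ‖b‖ ^ 2) = 1 := by
  rw [invNorm, inv_pow, Real.sq_sqrt (by positivity)]
  exact inv_mul_cancel₀ (by positivity)

theorem contDiff_invNorm : ContDiff ℝ ∞ invNorm := by
  unfold invNorm
  refine ContDiff.inv (ContDiff.sqrt (contDiff_const.add (contDiff_norm_sq ℝ)) ?_) ?_
  · intro x; positivity
  · intro x; positivity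

/-- The section of `SU(3) → ℂP²` over an affine chart. -/
def affineFrame (b : E4) : Matrix (Fin 3) (Fin 3) ℂ :=
  frameMatrix (invNorm b * cplx₁ b) (invNorm b * cplx₂ b) (invNorm b : ℝ)

theorem affineFrame_mem (b : E4) : affineFrame b ∈ Matrix.specialUnitaryGroup (Fin 3) ℂ := by
  refine frameMatrix_mem _ _ _ (invNorm_pos b) ?_
  have h := cplx_norm b
  have h2 : ((invNorm b : ℝ) : ℂ) ^ 2 * (1 + ((‖b‖ ^ 2 : ℝ) : ℂ)) = 1 := by
    exact_mod_cast invNorm_sq b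
  rw [← h] at h2
  simp only [map_mul, Complex.conj_ofReal]
  linear_combination h2

/-- The vector `(z₁, z₂, 1)`. -/
def affineVec (b : E4) : Fin 3 → ℂ := ![cplx₁ b, cplx₂ b, 1]

theorem affineFrame_col (b : E4) (i : Fin 3) :
    affineFrame b i 2 = invNorm b * affineVec b i := by
  fin_cases i <;> simp [affineFrame, frameMatrix, affineVec]

theorem contDiff_affineFrame (i j : Fin 3) : ContDiff ℝ ∞ (fun b => affineFrame b i j) := by
  have h₁ := contDiff_cplx₁
  have h₂ := contDiff_cplx₂
  have hc : ContDiff ℝ ∞ (fun b => ((invNorm b : ℝ) : ℂ)) :=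
    Complex.ofRealCLM.contDiff.comp contDiff_invNorm
  have g₁ := hc.mul h₁
  have g₂ := hc.mul h₂
  have k₁ := contDiff_conj.comp g₁
  have k₂ := contDiff_conj.comp g₂
  have hi : ContDiff ℝ ∞ (fun b => (1 + ((invNorm b : ℝ) : ℂ))⁻¹) := by
    refine (contDiff_const.add hc).inv fun b => ?_
    have : (1 + invNorm b : ℝ) ≠ 0 := by have := invNorm_pos b; positivity
    exact_mod_cast this
  fin_cases i <;> fin_cases j
  · exact contDiff_const.sub ((g₁.mul k₁).mul hi)
  · exact ((g₁.mul k₂).mul hi).neg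
  · exact g₁
  · exact ((g₂.mul k₁).mul hi).neg
  · exact contDiff_const.sub ((g₂.mul k₂).mul hi)
  · exact g₂
  · exact k₁.neg
  · exact k₂.neg
  · exact hc

/-- The quaternion `y ∈ ℝ⁴ = ℂ²` as a matrix acting on the first two coordinates. -/
def quatMatrix (y : E4) : Matrix (Fin 3) (Fin 3) ℂ :=
  !![cplx₁ y, -conj (cplx₂ y), 0; cplx₂ y, conj (cplx₁ y), 0; 0, 0, 0]

/-- The same matrix, acting as the identity on the last coordinate. -/
def blockMatrix (y : E4) : Matrix (Fin 3) (Fin 3) ℂ :=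
  quatMatrix y + Matrix.single 2 2 1

theorem blockMatrix_eq (y : E4) : blockMatrix y =
    !![cplx₁ y, -conj (cplx₂ y), 0; cplx₂ y, conj (cplx₁ y), 0; 0, 0, 1] := by
  ext i j
  fin_cases i <;> fin_cases j <;> simp [blockMatrix, quatMatrix, Matrix.single]

theorem star_blockMatrix_mul (y : E4) : star (blockMatrix y) * blockMatrix y =
    Matrix.diagonal ![((‖y‖ ^ 2 : ℝ) : ℂ), ((‖y‖ ^ 2 : ℝ) : ℂ), 1] := by
  rw [← cplx_norm, blockMatrix_eq]
  ext i j
  fin_cases i <;> fin_cases j <;>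
    simp [Matrix.mul_apply, Fin.sum_univ_three, Matrix.star_apply] <;> ring

theorem blockMatrix_mem (y : E4) (hy : ‖y‖ = 1) :
    blockMatrix y ∈ Matrix.specialUnitaryGroup (Fin 3) ℂ := by
  rw [Matrix.mem_specialUnitaryGroup_iff, Matrix.mem_unitaryGroup_iff']
  constructor
  · rw [star_blockMatrix_mul, hy]
    ext i j
    fin_cases i <;> fin_cases j <;> simp
  · have := cplx_norm y
    rw [hy] at this
    rw [blockMatrix_eq, Matrix.det_fin_three]
    simp at this ⊢
    linear_combination this

/-- Real linearity, which `blockMatrix` lacks because of its constant last entry. This is why the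
linear part is split off: it is the derivative of `blockMatrix`. -/
theorem quatMatrix_add_smul (y η : E4) (t : ℝ) :
    quatMatrix (y + t • η) = quatMatrix y + (t : ℂ) • quatMatrix η := by
  ext i j
  fin_cases i <;> fin_cases j <;>
    simp [quatMatrix, cplx₁_add, cplx₂_add, cplx₁_smul, cplx₂_smul]
  ring

theorem contDiff_blockMatrix (i j : Fin 3) : ContDiff ℝ ∞ (fun y => blockMatrix y i j) := by
  simp only [blockMatrix_eq]
  fin_cases i <;> fin_cases j
  · exact contDiff_cplx₁
  · exact (contDiff_conj.comp contDiff_cplx₂).neg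
  · exact contDiff_const
  · exact contDiff_cplx₂
  · exact contDiff_conj.comp contDiff_cplx₁
  all_goals exact contDiff_const

/-! ### Cyclic relabelling of the coordinates -/

/-- The cyclic permutation of the indices which takes `j` to `2`. -/
def relabel (j : Fin 3) : Fin 3 ≃ Fin 3 := Equiv.addRight (2 - j)

@[simp] theorem relabel_self (j : Fin 3) : relabel j j = 2 := by simp [relabel]
@[simp] theorem relabel_add_one (j : Fin 3) : relabel j (j + 1) = 0 := by
  revert j; decide
@[simp] theorem relabel_add_two (j : Fin 3) : relabel j (j + 2) = 1 := by
  revert j; decide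

theorem submatrix_equiv_mem (e : Fin 3 ≃ Fin 3) {M : Matrix (Fin 3) (Fin 3) ℂ}
    (hM : M ∈ Matrix.specialUnitaryGroup (Fin 3) ℂ) :
    M.submatrix e e ∈ Matrix.specialUnitaryGroup (Fin 3) ℂ := by
  rw [Matrix.mem_specialUnitaryGroup_iff, Matrix.mem_unitaryGroup_iff] at hM ⊢
  constructor
  · rw [Matrix.star_eq_conjTranspose, Matrix.conjTranspose_submatrix, Matrix.submatrix_mul_equiv,
      ← Matrix.star_eq_conjTranspose, hM.1, Matrix.submatrix_one_equiv]
  · rw [Matrix.det_submatrix_equiv_self, hM.2]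

/-- The ambient matrix of the map parametrising the fibres of the `j`-th projection. -/
def tubeMatrix (g : SU3) (j : Fin 3) (z : E4 × E4) : Matrix (Fin 3) (Fin 3) ℂ :=
  (g : Matrix (Fin 3) (Fin 3) ℂ) *
    (affineFrame z.1 * blockMatrix z.2).submatrix (relabel j) (relabel j)

theorem tubeMatrix_mem (g : SU3) (j : Fin 3) (b y : E4) (hy : ‖y‖ = 1) :
    tubeMatrix g j (b, y) ∈ Matrix.specialUnitaryGroup (Fin 3) ℂ :=
  mul_mem g.2 (submatrix_equiv_mem (relabel j) (mul_mem (affineFrame_mem b) (blockMatrix_mem y hy)))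

theorem contDiff_tubeMatrix (g : SU3) (j : Fin 3) (i i' : Fin 3) :
    ContDiff ℝ ∞ (fun z => tubeMatrix g j z i i') := by
  simp only [tubeMatrix, Matrix.mul_apply, Matrix.submatrix_apply]
  refine ContDiff.sum fun r _ => contDiff_const.mul (ContDiff.sum fun s _ => ?_)
  exact ((contDiff_affineFrame _ _).comp contDiff_fst).mul
    ((contDiff_blockMatrix _ _).comp contDiff_snd)

/-- Homogeneous coordinates on `ℂP²`, centred at the `j`-th column of `g`. -/
def lineVec (g : SU3) (j : Fin 3) (b : E4) : Fin 3 → ℂ :=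
  (g : Matrix (Fin 3) (Fin 3) ℂ).mulVec fun r => affineVec b (relabel j r)

/-- The block fixes the last basis vector, so the `j`-th column does not see `y`: each slice `{b} ×
S³` lies in a single fibre. -/
theorem tubeMatrix_col (g : SU3) (j : Fin 3) (b y : E4) (i : Fin 3) :
    tubeMatrix g j (b, y) i j = invNorm b * lineVec g j b i := by
  have h : ∀ r, (affineFrame b * blockMatrix y) r 2 = invNorm b * affineVec b r := fun r => by
    rw [← affineFrame_col, Matrix.mul_apply, Fin.sum_univ_three, blockMatrix_eq]
    simp
  simp only [tubeMatrix, Matrix.mul_apply, Matrix.submatrix_apply, lineVec, Matrix.mulVec,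
    dotProduct, relabel_self] at h ⊢
  rw [Finset.mul_sum]
  refine Finset.sum_congr rfl fun r _ => ?_
  rw [h]
  ring

/-- Valid for all `y`, not only unit vectors. The columns remain orthogonal off the sphere, so the
off-diagonal skewness of the Maurer–Cartan form can be obtained by differentiating in the ambient
`ℝ⁴ × ℝ⁴`. -/
theorem star_tubeMatrix_mul (g : SU3) (j : Fin 3) (b y : E4) :
    star (tubeMatrix g j (b, y)) * tubeMatrix g j (b, y) =
      Matrix.diagonal fun i => (![((‖y‖ ^ 2 : ℝ) : ℂ), ((‖y‖ ^ 2 : ℝ) : ℂ), 1] : Fin 3 → ℂ)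
        (relabel j i) := by
  have hg := Matrix.mem_unitaryGroup_iff'.1 (Matrix.mem_specialUnitaryGroup_iff.1 g.2).1
  have hP := Matrix.mem_unitaryGroup_iff'.1
    (Matrix.mem_specialUnitaryGroup_iff.1 (affineFrame_mem b)).1
  rw [tubeMatrix, star_mul, mul_assoc, ← mul_assoc (star (g : Matrix (Fin 3) (Fin 3) ℂ)), hg,
    one_mul, Matrix.star_eq_conjTranspose, Matrix.conjTranspose_submatrix,
    Matrix.submatrix_mul_equiv, ← Matrix.star_eq_conjTranspose, star_mul, mul_assoc,
    ← mul_assoc (star (affineFrame _)), hP, one_mul, star_blockMatrix_mul,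
    Matrix.submatrix_diagonal_equiv]
  rfl

/-! ### The parametrisation is an immersion -/

theorem hasFDerivAt_conj_mul {X : Type*} [NormedAddCommGroup X] [NormedSpace ℝ X]
    {f h : Fin 3 → X → ℂ} {x : X} (hf : ∀ r, DifferentiableAt ℝ (f r) x)
    (hh : ∀ r, DifferentiableAt ℝ (h r) x) :
    HasFDerivAt (fun y => ∑ r, conj (f r y) * h r y)
      (∑ r, (conj (f r x) • fderiv ℝ (h r) x +
        h r x • (Complex.conjCLE : ℂ →L[ℝ] ℂ).comp (fderiv ℝ (f r) x))) x := by
  refine HasFDerivAt.fun_sum fun r _ => ?_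
  exact ((Complex.conjCLE : ℂ →L[ℝ] ℂ).hasFDerivAt.comp x (hf r).hasFDerivAt).mul
    (hh r).hasFDerivAt

theorem fderiv_conj_mul {X : Type*} [NormedAddCommGroup X] [NormedSpace ℝ X]
    {f h : Fin 3 → X → ℂ} {x : X} (hf : ∀ r, DifferentiableAt ℝ (f r) x)
    (hh : ∀ r, DifferentiableAt ℝ (h r) x) (ξ : X) :
    fderiv ℝ (fun y => ∑ r, conj (f r y) * h r y) x ξ =
      ∑ r, (conj (f r x) * fderiv ℝ (h r) x ξ + h r x * conj (fderiv ℝ (f r) x ξ)) := by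
  rw [(hasFDerivAt_conj_mul hf hh).fderiv]
  simp

theorem maurerCartan_apply {V : Type*} [AddCommGroup V] [Module ℝ V] [TopologicalSpace V]
    (g : SU3) (dg : Fin 3 → Fin 3 → V →L[ℝ] ℂ) (i j : Fin 3) (v : V) :
    maurerCartan g dg i j v = ∑ r, conj ((g : Matrix (Fin 3) (Fin 3) ℂ) r i) * dg r j v := by
  simp [maurerCartan]

theorem coframe_off {V : Type*} [AddCommGroup V] [Module ℝ V] [TopologicalSpace V] {k l : ℤ}
    {Ω : Fin 3 → Fin 3 → V →L[ℝ] ℂ} {v : V} (h : ∀ a, coframe k l Ω a v = 0) :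
    Ω 0 1 v = 0 ∧ Ω 1 2 v = 0 ∧ Ω 2 0 v = 0 := by
  have h2 : √2 ≠ 0 := by positivity
  have h0 := h 0
  have h1 := h 1
  have h3 := h 2
  have h4 := h 4
  have h5 := h 5
  have h6 := h 6
  simp [coframe, h2] at h0 h1 h3 h4 h5 h6
  exact ⟨Complex.ext h0 h4, Complex.ext h1 h5, Complex.ext h3 h6⟩

theorem sNorm_pos {k l : ℤ} {j : Fin 3} (hw : weight k l j ≠ 0) : 0 < sNorm k l := by
  refine Real.sqrt_pos.2 (div_pos ?_ (by norm_num))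
  refine Finset.sum_pos' (fun i _ => sq_nonneg _) ⟨j, Finset.mem_univ _, ?_⟩
  have : (weight k l j : ℝ) ≠ 0 := by exact_mod_cast hw
  positivity

theorem coframe_three {V : Type*} [AddCommGroup V] [Module ℝ V] [TopologicalSpace V] {k l : ℤ}
    {j : Fin 3} (hw : weight k l j ≠ 0)
    {Ω : Fin 3 → Fin 3 → V →L[ℝ] ℂ} {v : V} (h : coframe k l Ω 3 v = 0) :
    ∑ i, (coweight k l i : ℝ) * (Ω i i v).im = 0 := by
  have hs := (sNorm_pos hw).ne'
  have h2 : √2 ≠ 0 := by positivity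
  simpa [coframe, h2, hs] using h

theorem star_mul_apply (M N : Matrix (Fin 3) (Fin 3) ℂ) (i i' : Fin 3) :
    (star M * N) i i' = ∑ r, conj (M r i) * N r i' := by
  simp [Matrix.mul_apply, Matrix.star_apply]

theorem mul_maurerCartan {V : Type*} [AddCommGroup V] [Module ℝ V] [TopologicalSpace V]
    (g : SU3) (dg : Fin 3 → Fin 3 → V →L[ℝ] ℂ) (i j : Fin 3) (v : V) :
    dg i j v = ∑ s, (g : Matrix (Fin 3) (Fin 3) ℂ) i s * maurerCartan g dg s j v := by
  have hg := Matrix.mem_unitaryGroup_iff.1 (Matrix.mem_specialUnitaryGroup_iff.1 g.2).1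
  have h : (Matrix.of fun i j => dg i j v) = (g : Matrix (Fin 3) (Fin 3) ℂ) *
      (star (g : Matrix (Fin 3) (Fin 3) ℂ) * Matrix.of fun i j => dg i j v) := by
    rw [← mul_assoc, hg, one_mul]
  have h' := congrFun (congrFun h i) j
  rw [Matrix.mul_apply] at h'
  simpa only [star_mul_apply, Matrix.of_apply, ← maurerCartan_apply] using h'

theorem fderiv_cplx₁ (b v : E4) : fderiv ℝ cplx₁ b v = cplx₁ v := by
  have h := ((contDiff_cplx₁.differentiable (by simp)) b).lineDeriv_eq_fderiv (v := v)
  rw [← h, lineDeriv]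
  simp only [cplx₁_add, cplx₁_smul]
  have : HasDerivAt (fun t : ℝ => cplx₁ b + (t : ℂ) * cplx₁ v) (1 * cplx₁ v) 0 :=
    ((Complex.ofRealCLM.hasDerivAt (x := (0 : ℝ))).mul_const _).const_add _
  simpa using this.deriv

theorem fderiv_cplx₂ (b v : E4) : fderiv ℝ cplx₂ b v = cplx₂ v := by
  have h := ((contDiff_cplx₂.differentiable (by simp)) b).lineDeriv_eq_fderiv (v := v)
  rw [← h, lineDeriv]
  simp only [cplx₂_add, cplx₂_smul]
  have : HasDerivAt (fun t : ℝ => cplx₂ b + (t : ℂ) * cplx₂ v) (1 * cplx₂ v) 0 :=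
    ((Complex.ofRealCLM.hasDerivAt (x := (0 : ℝ))).mul_const _).const_add _
  simpa using this.deriv

/-- In the frame `g`, the `j`-th column of `tubeMatrix g j` is `(z₁, z₂, 1)/√(1 + |z|²)`. -/
theorem star_mul_tubeMatrix_col (g : SU3) (j : Fin 3) (z : E4 × E4) (i : Fin 3) :
    ∑ r, conj ((g : Matrix (Fin 3) (Fin 3) ℂ) r i) * tubeMatrix g j z r j =
      invNorm z.1 * affineVec z.1 (relabel j i) := by
  have hg := Matrix.mem_unitaryGroup_iff'.1 (Matrix.mem_specialUnitaryGroup_iff.1 g.2).1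
  have h : ∀ r, tubeMatrix g j z r j = invNorm z.1 * lineVec g j z.1 r :=
    fun r => tubeMatrix_col g j z.1 z.2 r
  have h' : (star (g : Matrix (Fin 3) (Fin 3) ℂ)).mulVec (lineVec g j z.1) =
      fun r => affineVec z.1 (relabel j r) := by
    rw [lineVec, Matrix.mulVec_mulVec, hg, Matrix.one_mulVec]
  rw [← congrFun h' i, Matrix.mulVec, dotProduct, Finset.mul_sum]
  refine Finset.sum_congr rfl fun r _ => ?_
  rw [h, Matrix.star_apply]
  simp only [RCLike.star_def]
  ring

theorem fderiv_tubeMatrix_snd (g : SU3) (j : Fin 3) (b x η : E4) (i i' : Fin 3) :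
    fderiv ℝ (fun z => tubeMatrix g j z i i') (b, x) (0, η) =
      ((g : Matrix (Fin 3) (Fin 3) ℂ) *
        (affineFrame b * quatMatrix η).submatrix (relabel j) (relabel j)) i i' := by
  have h := ((contDiff_tubeMatrix g j i i').differentiable (by simp) (b, x)).lineDeriv_eq_fderiv
    (v := ((0 : E4), η))
  rw [← h, lineDeriv]
  set N := ((g : Matrix (Fin 3) (Fin 3) ℂ) *
        (affineFrame b * quatMatrix η).submatrix (relabel j) (relabel j)) with hN
  have e : ∀ t : ℝ, tubeMatrix g j ((b, x) + t • ((0 : E4), η)) i i' =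
      tubeMatrix g j (b, x) i i' + (t : ℂ) * N i i' := fun t => by
    have hq := quatMatrix_add_smul x η t
    have : tubeMatrix g j ((b, x) + t • ((0 : E4), η)) = tubeMatrix g j (b, x) + (t : ℂ) • N := by
      simp only [tubeMatrix, Prod.smul_mk, smul_zero, Prod.mk_add_mk, add_zero, blockMatrix, hq,
        hN]
      rw [add_right_comm, mul_add, Matrix.submatrix_add, Pi.add_apply, Pi.add_apply,
        mul_add (g : Matrix (Fin 3) (Fin 3) ℂ), Matrix.mul_smul, Matrix.submatrix_smul,
        Pi.smul_apply, Pi.smul_apply, Matrix.mul_smul]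
    rw [this]
    simp
  simp only [e]
  have : HasDerivAt (fun t : ℝ => tubeMatrix g j (b, x) i i' + (t : ℂ) * N i i')
      (1 * N i i') 0 :=
    ((Complex.ofRealCLM.hasDerivAt (x := (0 : ℝ))).mul_const _).const_add _
  simpa using this.deriv

theorem star_blockMatrix_mul_quatMatrix (x η : E4) :
    (star (blockMatrix x) * quatMatrix η) 0 0 =
        conj (cplx₁ x) * cplx₁ η + conj (cplx₂ x) * cplx₂ η ∧
      (star (blockMatrix x) * quatMatrix η) 1 0 = cplx₁ x * cplx₂ η - cplx₂ x * cplx₁ η ∧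
      (star (blockMatrix x) * quatMatrix η) 1 1 =
        conj (conj (cplx₁ x) * cplx₁ η + conj (cplx₂ x) * cplx₂ η) ∧
      (star (blockMatrix x) * quatMatrix η) 2 2 = 0 := by
  simp only [star_mul_apply, Fin.sum_univ_three, blockMatrix_eq]
  simp [quatMatrix]
  constructor <;> ring

/-- The two expressions are the complex components of the quaternion product `x̄ η`, and multiplying
by the unit quaternion `x` recovers `η`. -/
theorem eq_zero_of_quat {x η : E4} (hx : ‖x‖ = 1)
    (hp : conj (cplx₁ x) * cplx₁ η + conj (cplx₂ x) * cplx₂ η = 0)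
    (hq : cplx₁ x * cplx₂ η - cplx₂ x * cplx₁ η = 0) : η = 0 := by
  have hn := cplx_norm x
  rw [hx] at hn
  simp only [one_pow, Complex.ofReal_one] at hn
  refine cplx_ext ?_ ?_
  · rw [cplx₁_zero]
    linear_combination cplx₁ x * hp - conj (cplx₂ x) * hq - cplx₁ η * hn
  · rw [cplx₂_zero]
    linear_combination cplx₂ x * hp + conj (cplx₁ x) * hq - cplx₂ η * hn

theorem inner_eq_re (x η : E4) : inner ℝ x η =
    (conj (cplx₁ x) * cplx₁ η + conj (cplx₂ x) * cplx₂ η).re := by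
  simp [PiLp.inner_apply, Fin.sum_univ_four, cplx₁, cplx₂]
  ring

/-- Up to a factor, this is the value of `e⁴` on the diagonal generator of the `SU(2)` that fixes
the `j`-th coordinate. It is nonzero exactly when the `j`-th weight is. -/
theorem coweight_sub (k l : ℤ) (j : Fin 3) :
    (coweight k l (j + 1) : ℝ) - coweight k l (j + 2) = -3 * weight k l j := by
  have : coweight k l (j + 1) - coweight k l (j + 2) = -3 * weight k l j := by
    fin_cases j <;> simp [coweight, weight] <;> ring
  exact_mod_cast this

theorem sum_fin_three_cyclic {M : Type*} [AddCommMonoid M] (f : Fin 3 → M) (j : Fin 3) :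
    ∑ i, f i = f j + f (j + 1) + f (j + 2) := by
  rw [Fin.sum_univ_three]
  fin_cases j
  · rfl
  · change _ = f 1 + f 2 + f 0
    abel
  · change _ = f 2 + f 0 + f 1
    abel

/-- If all `eᵃ` vanish, then `Ω` is diagonal. Hence the `j`-th column moves within its line, which
kills the `ℂP²` component of `ξ`; what remains is a tangent vector of `SU(2)` on which the
off-diagonal entry and `e⁴` vanish. The domain `V` of `dg` is left abstract so that both the charts
on `ℝ⁷` and the manifold derivative on `ℝ⁴ × S³` can use the statement. -/
theorem tubeMatrix_immersive {V : Type*} [AddCommGroup V] [Module ℝ V] [TopologicalSpace V]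
    {k l : ℤ} {j : Fin 3} (hw : weight k l j ≠ 0) (g h : SU3) {b x : E4} (hx : ‖x‖ = 1)
    (hh : (h : Matrix (Fin 3) (Fin 3) ℂ) = tubeMatrix g j (b, x))
    (dg : Fin 3 → Fin 3 → V →L[ℝ] ℂ) (v : V) (ξ : E4 × E4)
    (hdg : ∀ i i', dg i i' v = fderiv ℝ (fun z => tubeMatrix g j z i i') (b, x) ξ)
    (hξ : inner ℝ x ξ.2 = 0) (hco : ∀ a, coframe k l (maurerCartan h dg) a v = 0) : ξ = 0 := by
  have hd : ∀ i i', DifferentiableAt ℝ (fun z => tubeMatrix g j z i i') (b, x) := fun i i' =>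
    (contDiff_tubeMatrix g j i i').differentiable (by simp) _
  set Ω := maurerCartan h dg with hΩ
  have skew : ∀ i i', i ≠ i' → Ω i i' v = -conj (Ω i' i v) := by
    intro i i' hne
    have h0 : (fun z : E4 × E4 => ∑ r, conj (tubeMatrix g j z r i) * tubeMatrix g j z r i') =
        fun _ => 0 := by
      funext z
      rw [← star_mul_apply, star_tubeMatrix_mul g j z.1 z.2, Matrix.diagonal_apply_ne _ hne]
    have h1 := fderiv_conj_mul (f := fun r z => tubeMatrix g j z r i)
      (h := fun r z => tubeMatrix g j z r i') (fun r => hd r i) (fun r => hd r i') ξ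
    rw [h0] at h1
    simp only [fderiv_const_apply, zero_apply, ← hdg, ← hh,
      Finset.sum_add_distrib] at h1
    rw [hΩ, maurerCartan_apply, maurerCartan_apply, map_sum]
    simp only [map_mul, Complex.conj_conj]
    linear_combination -h1
  obtain ⟨h01, h12, h20⟩ := coframe_off hco
  have off : ∀ i i', i ≠ i' → Ω i i' v = 0 := by
    have h10 := skew 1 0 (by decide)
    have h21 := skew 2 1 (by decide)
    have h02 := skew 0 2 (by decide)
    rw [h01, map_zero, neg_zero] at h10
    rw [h12, map_zero, neg_zero] at h21
    rw [h20, map_zero, neg_zero] at h02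
    intro i i' hne
    fin_cases i <;> fin_cases i' <;> first | exact absurd rfl hne | assumption
  have hcol : ∀ r, dg r j v = tubeMatrix g j (b, x) r j * Ω j j v := by
    intro r
    rw [mul_maurerCartan h dg r j v, Finset.sum_eq_single j, hh]
    · intro s _ hs
      rw [← hΩ, off s j hs, mul_zero]
    · simp
  -- the first component vanishes
  have hinv : ((invNorm b : ℝ) : ℂ) ≠ 0 := by exact_mod_cast (invNorm_pos b).ne'
  set col : Fin 3 → E4 × E4 → ℂ := fun i z =>
    ∑ r, conj ((g : Matrix (Fin 3) (Fin 3) ℂ) r i) * tubeMatrix g j z r j with hcoldef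
  have dcol : ∀ i, HasFDerivAt (col i) (∑ r, conj ((g : Matrix (Fin 3) (Fin 3) ℂ) r i) •
      fderiv ℝ (fun z => tubeMatrix g j z r j) (b, x)) (b, x) := fun i =>
    HasFDerivAt.fun_sum fun r _ => (hd r j).hasFDerivAt.const_mul _
  have dcol' : ∀ i, fderiv ℝ (col i) (b, x) ξ = col i (b, x) * Ω j j v := fun i => by
    rw [(dcol i).fderiv]
    simp only [sum_apply, smul_apply, ← hdg, hcol,
      smul_eq_mul, hcoldef, Finset.sum_mul, mul_assoc]
  have col0 : ∀ z, col j z = invNorm z.1 := fun z => by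
    simp only [hcoldef]
    rw [star_mul_tubeMatrix_col, relabel_self]
    simp [affineVec]
  -- Seen in the frame `g`, the affine coordinates are ratios of entries of the `j`-th column. A
  -- column whose derivative is a multiple of itself has stationary ratios.
  have col1 : col (j + 1) = fun z => cplx₁ z.1 * col j z := by
    funext z
    rw [col0]
    simp only [hcoldef]
    rw [star_mul_tubeMatrix_col, relabel_add_one]
    simp [affineVec, mul_comm]
  have col2 : col (j + 2) = fun z => cplx₂ z.1 * col j z := by
    funext z
    rw [col0]
    simp only [hcoldef]
    rw [star_mul_tubeMatrix_col, relabel_add_two]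
    simp [affineVec, mul_comm]
  have hc1 : HasFDerivAt (fun z : E4 × E4 => cplx₁ z.1)
      ((fderiv ℝ cplx₁ b).comp (ContinuousLinearMap.fst ℝ E4 E4)) (b, x) := by
    have : HasFDerivAt cplx₁ (fderiv ℝ cplx₁ b) (Prod.fst (b, x)) :=
      (contDiff_cplx₁.differentiable (by simp) b).hasFDerivAt
    exact this.comp (b, x) hasFDerivAt_fst
  have hc2 : HasFDerivAt (fun z : E4 × E4 => cplx₂ z.1)
      ((fderiv ℝ cplx₂ b).comp (ContinuousLinearMap.fst ℝ E4 E4)) (b, x) := by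
    have : HasFDerivAt cplx₂ (fderiv ℝ cplx₂ b) (Prod.fst (b, x)) :=
      (contDiff_cplx₂.differentiable (by simp) b).hasFDerivAt
    exact this.comp (b, x) hasFDerivAt_fst
  have hj := (dcol j).differentiableAt.hasFDerivAt
  have e1 := dcol' (j + 1)
  have e2 := dcol' (j + 2)
  rw [col1, (hc1.fun_mul hj).fderiv] at e1
  rw [col2, (hc2.fun_mul hj).fderiv] at e2
  simp only [add_apply, smul_apply, dcol',
    ContinuousLinearMap.comp_apply, ContinuousLinearMap.coe_fst', fderiv_cplx₁, fderiv_cplx₂,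
    smul_eq_mul, col0] at e1 e2
  have hv1 : cplx₁ ξ.1 = 0 := by
    have : (invNorm b : ℂ) * cplx₁ ξ.1 = 0 := by linear_combination e1
    exact (mul_eq_zero.1 this).resolve_left hinv
  have hv2 : cplx₂ ξ.1 = 0 := by
    have : (invNorm b : ℂ) * cplx₂ ξ.1 = 0 := by linear_combination e2
    exact (mul_eq_zero.1 this).resolve_left hinv
  have hξ1 : ξ.1 = 0 := cplx_ext (by rw [hv1, cplx₁_zero]) (by rw [hv2, cplx₂_zero])
  -- the second component vanishes
  have hξ' : ξ = (0, ξ.2) := Prod.ext hξ1 rfl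
  have hN : ∀ i i', Ω i i' v =
      (star (blockMatrix x) * quatMatrix ξ.2) (relabel j i) (relabel j i') := by
    intro i i'
    have hg := Matrix.mem_unitaryGroup_iff'.1 (Matrix.mem_specialUnitaryGroup_iff.1 g.2).1
    have hP := Matrix.mem_unitaryGroup_iff'.1
      (Matrix.mem_specialUnitaryGroup_iff.1 (affineFrame_mem b)).1
    have hD : ∀ r, dg r i' v = ((g : Matrix (Fin 3) (Fin 3) ℂ) *
        (affineFrame b * quatMatrix ξ.2).submatrix (relabel j) (relabel j)) r i' := fun r => by
      rw [hdg, hξ', fderiv_tubeMatrix_snd]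
    rw [hΩ, maurerCartan_apply]
    simp only [hD]
    rw [← star_mul_apply, hh, tubeMatrix, star_mul, mul_assoc,
      ← mul_assoc (star (g : Matrix (Fin 3) (Fin 3) ℂ)), hg,
      one_mul, Matrix.star_eq_conjTranspose, Matrix.conjTranspose_submatrix,
      Matrix.submatrix_mul_equiv, ← Matrix.star_eq_conjTranspose, star_mul, mul_assoc,
      ← mul_assoc (star (affineFrame _)), hP, one_mul, Matrix.submatrix_apply]
  obtain ⟨q00, q10, q11, q22⟩ := star_blockMatrix_mul_quatMatrix x ξ.2
  have hq := off (j + 2) (j + 1) (by simp)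
  rw [hN, relabel_add_one, relabel_add_two, q10] at hq
  have h3 := coframe_three hw (hco 3)
  rw [sum_fin_three_cyclic _ j] at h3
  simp only [hN, relabel_add_one, relabel_add_two, relabel_self, q00, q11, q22] at h3
  have hre := inner_eq_re x ξ.2
  rw [hξ] at hre
  set p := conj (cplx₁ x) * cplx₁ ξ.2 + conj (cplx₂ x) * cplx₂ ξ.2 with hp
  -- The diagonal entries of `Ω` are `p`, `conj p` and `0`, so `e⁴ = 0` controls `p.im`; tangency to
  -- the sphere controls `p.re`.
  have him : (-3 * weight k l j : ℝ) * p.im = 0 := by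
    rw [← coweight_sub]
    simp only [Complex.zero_im, mul_zero, zero_add, Complex.conj_im] at h3
    linear_combination h3
  have hw' : (weight k l j : ℝ) ≠ 0 := by exact_mod_cast hw
  have hp0 : p = 0 := Complex.ext hre.symm
    ((mul_eq_zero.1 him).resolve_left (mul_ne_zero (by norm_num) hw'))
  exact Prod.ext hξ1 (eq_zero_of_quat hx hp0 hq)

/-! ### Fibres as images of `S³` -/

/-- The map `ℝ⁴ × S³ → SU(3)` whose slices parametrise fibres of the `j`-th projection. -/
def tube (g : SU3) (j : Fin 3) (z : E4 × S3) : SU3 :=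
  ⟨tubeMatrix g j (z.1, z.2.1), tubeMatrix_mem g j z.1 z.2.1 (norm_eq_of_mem_sphere z.2)⟩

/-- The base point of the fibre over `b`. -/
def tubeBase (g : SU3) (j : Fin 3) (b : E4) : SU3 :=
  g * ⟨_, submatrix_equiv_mem (relabel j) (affineFrame_mem b)⟩

theorem tubeMatrix_eq_base (g : SU3) (j : Fin 3) (z : E4 × E4) :
    tubeMatrix g j z = (tubeBase g j z.1 : Matrix (Fin 3) (Fin 3) ℂ) *
      (blockMatrix z.2).submatrix (relabel j) (relabel j) := by
  rw [tubeMatrix, tubeBase, Submonoid.coe_mul, mul_assoc, Matrix.submatrix_mul_equiv]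

/-- The characters of the maximal torus on the circle. -/
def phase (k l : ℤ) (θ : ℝ) (i : Fin 3) : ℂ :=
  Complex.exp (Complex.I * (weight k l i : ℂ) * (θ : ℂ))

theorem weight_sum (k l : ℤ) (j : Fin 3) :
    weight k l j + weight k l (j + 1) + weight k l (j + 2) = 0 := by
  rw [← sum_fin_three_cyclic, Fin.sum_univ_three]
  simp [weight]

theorem phase_mul (k l : ℤ) (θ : ℝ) (j : Fin 3) :
    phase k l θ j * phase k l θ (j + 1) * phase k l θ (j + 2) = 1 := by
  have h : (weight k l j : ℂ) + weight k l (j + 1) + weight k l (j + 2) = 0 := by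
    exact_mod_cast weight_sum k l j
  rw [phase, phase, phase, ← Complex.exp_add, ← Complex.exp_add, ← Complex.exp_zero]
  congr 1
  linear_combination Complex.I * θ * h

theorem phase_mul_conj (k l : ℤ) (θ : ℝ) (j : Fin 3) :
    phase k l θ j * conj (phase k l θ j) = 1 := by
  rw [phase, ← Complex.exp_conj, ← Complex.exp_add, ← Complex.exp_zero]
  congr 1
  simp

theorem diagonal_phase_mem (k l : ℤ) (θ : ℝ) :
    Matrix.diagonal (phase k l θ) ∈ Matrix.specialUnitaryGroup (Fin 3) ℂ := by
  rw [Matrix.mem_specialUnitaryGroup_iff, Matrix.mem_unitaryGroup_iff]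
  constructor
  · rw [Matrix.star_eq_conjTranspose, Matrix.diagonal_conjTranspose,
      Matrix.diagonal_mul_diagonal, ← Matrix.diagonal_one]
    congr 1
    funext i
    exact phase_mul_conj k l θ i
  · rw [Matrix.det_diagonal, Fin.prod_univ_three]
    exact phase_mul k l θ 0

theorem isCoprime_weight {k l : ℤ} (h : IsCoprime k l) (j : Fin 3) :
    IsCoprime (weight k l j) (weight k l (j + 1)) := by
  fin_cases j
  · exact h
  · change IsCoprime l (-k - l)
    have : IsCoprime l (-k + l * (-1)) := (IsCoprime.add_mul_left_right_iff).2 h.symm.neg_right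
    convert this using 1
    ring
  · change IsCoprime (-k - l) k
    have : IsCoprime (-l + k * (-1)) k := (IsCoprime.add_mul_left_left_iff).2 h.symm.neg_left
    convert this using 1
    ring

theorem weight_ne_zero {k l : ℤ} (hk : k ≠ 0) (hl : l ≠ 0) (hkl : IsCoprime k l)
    (hgen : ({k, l, -k - l} : Multiset ℤ) ≠ {1, -1, 0}) (j : Fin 3) : weight k l j ≠ 0 := by
  fin_cases j
  · exact hk
  · exact hl
  · change -k - l ≠ 0
    intro h
    have hl' : l = -k := by linarith
    subst hl'
    have hu : IsUnit k := by
      have := (isCoprime_self (x := k)).1 (by simpa using hkl.neg_right)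
      exact this
    rcases Int.isUnit_iff.1 hu with rfl | rfl
    · exact hgen (by decide)
    · exact hgen (by decide)

/-- Raising the `i`-th phase to the power `w_j` gives the same number as raising the `j`-th phase to
the power `w_i`, namely `exp(i w_i w_j θ)`. -/
theorem phase_pow_eq_one {k l : ℤ} {j : Fin 3} {θ : ℝ} (h : phase k l θ j = 1) (i : Fin 3) :
    phase k l θ i ^ (weight k l j).natAbs = 1 := by
  have hz : phase k l θ i ^ (weight k l j) = 1 := by
    have : phase k l θ i ^ (weight k l j) = phase k l θ j ^ (weight k l i) := by
      rw [phase, phase, ← Complex.exp_int_mul, ← Complex.exp_int_mul]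
      congr 1
      ring
    rw [this, h, one_zpow]
  rcases Int.natAbs_eq (weight k l j) with h' | h'
  · rw [h', zpow_natCast] at hz
    exact hz
  · rw [h', zpow_neg, zpow_natCast] at hz
    exact inv_eq_one.1 hz

theorem exists_phase {k l : ℤ} (hkl : IsCoprime k l) {j : Fin 3} (hw : weight k l j ≠ 0) {ζ : ℂ}
    (hζ : ζ ^ (weight k l j).natAbs = 1) :
    ∃ θ : ℝ, phase k l θ j = 1 ∧ phase k l θ (j + 1) = ζ := by
  obtain ⟨u, v, huv⟩ := isCoprime_weight hkl j
  have hp : (weight k l j).natAbs ≠ 0 := Int.natAbs_ne_zero.2 hw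
  have : NeZero (weight k l j).natAbs := ⟨hp⟩
  have hprim := Complex.isPrimitiveRoot_exp _ hp
  obtain ⟨n, -, hn⟩ := hprim.eq_pow_of_pow_eq_one hζ
  -- `w / |w|` is the sign of the weight
  obtain ⟨ε, hε⟩ : ∃ ε : ℤ, ((weight k l j).natAbs : ℤ) = ε * weight k l j := by
    rcases Int.natAbs_eq (weight k l j) with h' | h'
    · exact ⟨1, by omega⟩
    · exact ⟨-1, by omega⟩
  have hε2 : ε * ε = 1 := by
    have h1 : ((weight k l j).natAbs : ℤ) * (weight k l j).natAbs = weight k l j * weight k l j :=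
      Int.natAbs_mul_self
    rw [hε] at h1
    have h2 : weight k l j * weight k l j ≠ 0 := mul_ne_zero hw hw
    exact mul_right_cancel₀ h2 (by linear_combination h1)
  have hwC : (weight k l j : ℂ) ≠ 0 := by exact_mod_cast hw
  have hεC : ((weight k l j).natAbs : ℂ) = ε * weight k l j := by
    rw [← Int.cast_natCast (R := ℂ), hε, Int.cast_mul]
  have hε2C : (ε : ℂ) * ε = 1 := by exact_mod_cast hε2
  have huvC : (u : ℂ) * weight k l j + v * weight k l (j + 1) = 1 := by exact_mod_cast huv
  -- By Bézout, `v w_{j+1} / w_j` equals `1 / w_j` modulo integers. The sign `ε` turns `1 / w_j`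
  -- into `1 / |w_j|`, so the phase at `j + 1` is `exp(2πi n / |w_j|) = ζ`.
  refine ⟨2 * Real.pi * (ε * n * v) / weight k l j, ?_, ?_⟩
  · rw [phase, Complex.exp_eq_one_iff]
    refine ⟨ε * n * v, ?_⟩
    push_cast
    field_simp
  · rw [← hn, ← Complex.exp_nat_mul, phase, Complex.exp_eq_exp_iff_exists_int]
    refine ⟨-(ε * n * u), ?_⟩
    have hε0 : (ε : ℂ) ≠ 0 := left_ne_zero_of_mul_eq_one hε2C
    rw [hεC]
    push_cast
    field_simp
    linear_combination (n : ℂ) * hε2C + (n : ℂ) * ε * ε * huvC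

theorem mk_eq_mk_iff (k l : ℤ) (a b : SU3) : (a : W k l) = (b : W k l) ↔
    ∃ θ : ℝ, (b : Matrix (Fin 3) (Fin 3) ℂ) = a * Matrix.diagonal (phase k l θ) := by
  rw [QuotientGroup.eq]
  constructor
  · rintro ⟨θ, hθ⟩
    refine ⟨θ, ?_⟩
    change _ = _ * Matrix.diagonal fun j => Complex.exp (Complex.I * (weight k l j : ℂ) * (θ : ℂ))
    rw [← hθ, ← Submonoid.coe_mul, mul_inv_cancel_left]
  · rintro ⟨θ, hθ⟩
    refine ⟨θ, ?_⟩
    have ha : ((a⁻¹ : SU3) : Matrix (Fin 3) (Fin 3) ℂ) * a = 1 := by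
      rw [← Submonoid.coe_mul, inv_mul_cancel]; rfl
    rw [Submonoid.coe_mul, hθ, ← mul_assoc, ha, one_mul]
    rfl

theorem mem_fibre_iff (k l : ℤ) (j : Fin 3) (h : SU3) (w : Fin 3 → ℂ) (hw : w ≠ 0) :
    (h : W k l) ∈ fibre k l j (Projectivization.mk ℂ w hw) ↔
      ∃ a : ℂ, ∀ i, (h : Matrix (Fin 3) (Fin 3) ℂ) i j = a * w i := by
  change Projectivization.mk ℂ (fun i => (h : Matrix (Fin 3) (Fin 3) ℂ) i j) (col_ne_zero h j) = _
    ↔ _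
  rw [Projectivization.mk_eq_mk_iff']
  refine exists_congr fun a => ?_
  rw [funext_iff]
  exact forall_congr' fun i => eq_comm

theorem star_mulVec_lineVec (g : SU3) (j : Fin 3) (b : E4) :
    (star (g : Matrix (Fin 3) (Fin 3) ℂ)).mulVec (lineVec g j b) =
      fun r => affineVec b (relabel j r) := by
  have hg := Matrix.mem_unitaryGroup_iff'.1 (Matrix.mem_specialUnitaryGroup_iff.1 g.2).1
  rw [lineVec, Matrix.mulVec_mulVec, hg, Matrix.one_mulVec]

theorem lineVec_ne_zero (g : SU3) (j : Fin 3) (b : E4) : lineVec g j b ≠ 0 := by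
  intro h
  have h' := congrFun (star_mulVec_lineVec g j b) j
  rw [h, Matrix.mulVec_zero, relabel_self] at h'
  simp [affineVec] at h'

theorem lineVec_inj {g : SU3} {j : Fin 3} {b b' : E4} {a : ℂ}
    (h : lineVec g j b = a • lineVec g j b') : b = b' := by
  have h' := congrArg (star (g : Matrix (Fin 3) (Fin 3) ℂ)).mulVec h
  rw [Matrix.mulVec_smul, star_mulVec_lineVec, star_mulVec_lineVec] at h'
  have h0 := congrFun h' j
  have h1 := congrFun h' (j + 1)
  have h2 := congrFun h' (j + 2)
  simp only [Pi.smul_apply, relabel_self, relabel_add_one, relabel_add_two, smul_eq_mul] at h0 h1 h2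
  simp [affineVec] at h0 h1 h2
  subst h0
  exact cplx_ext (by simpa using h1) (by simpa using h2)

/-- The point of `ℂP²` with homogeneous coordinates `lineVec g j b`. -/
def linePoint (g : SU3) (j : Fin 3) (b : E4) : CP2 :=
  Projectivization.mk ℂ (lineVec g j b) (lineVec_ne_zero g j b)

theorem linePoint_injective (g : SU3) (j : Fin 3) : Function.Injective (linePoint g j) := by
  intro b b' h
  obtain ⟨a, ha⟩ := (Projectivization.mk_eq_mk_iff' ℂ _ _ _ _).1 h
  exact lineVec_inj ha.symm

theorem proj_tube (k l : ℤ) (g : SU3) (j : Fin 3) (z : E4 × S3) :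
    proj k l j (tube g j z : W k l) = linePoint g j z.1 := by
  refine (mem_fibre_iff k l j (tube g j z) _ (lineVec_ne_zero g j z.1)).2 ⟨invNorm z.1, fun i => ?_⟩
  exact tubeMatrix_col g j z.1 z.2.1 i

theorem sameOrbit_iff (p : ℕ) (x y : S3) : SameOrbit p x y ↔
    ∃ ζ : ℂ, ζ ^ p = 1 ∧ cplx₁ y.1 = ζ * cplx₁ x.1 ∧ cplx₂ y.1 = ζ * cplx₂ x.1 := Iff.rfl

theorem block_eq_mul_diagonal_iff (j : Fin 3) (x y : E4) (d : Fin 3 → ℂ) :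
    (blockMatrix y).submatrix (relabel j) (relabel j) =
      (blockMatrix x).submatrix (relabel j) (relabel j) * Matrix.diagonal d ↔
    blockMatrix y = blockMatrix x * Matrix.diagonal ![d (j + 1), d (j + 2), d j] := by
  have hd : d = (![d (j + 1), d (j + 2), d j] : Fin 3 → ℂ) ∘ relabel j := by
    funext i
    have : i = j ∨ i = j + 1 ∨ i = j + 2 := by revert i j; decide
    rcases this with rfl | rfl | rfl <;> simp
  have hdiag : Matrix.diagonal d =
      (Matrix.diagonal (![d (j + 1), d (j + 2), d j] : Fin 3 → ℂ)).submatrix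
        (relabel j) (relabel j) := by
    rw [Matrix.submatrix_diagonal_equiv, ← hd]
  rw [hdiag, Matrix.submatrix_mul_equiv]
  constructor
  · intro h
    ext r s
    have := congrFun (congrFun h ((relabel j).symm r)) ((relabel j).symm s)
    simpa only [Matrix.submatrix_apply, Equiv.apply_symm_apply] using this
  · intro h
    rw [h]

theorem block_mul_diagonal (x : E4) (d : Fin 3 → ℂ) (y : E4) :
    blockMatrix y = blockMatrix x * Matrix.diagonal d ↔
      cplx₁ y = d 0 * cplx₁ x ∧ cplx₂ y = d 0 * cplx₂ x ∧
      conj (cplx₁ y) = d 1 * conj (cplx₁ x) ∧ conj (cplx₂ y) = d 1 * conj (cplx₂ x) ∧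
      d 2 = 1 := by
  rw [← Matrix.ext_iff]
  simp only [Matrix.mul_diagonal, blockMatrix_eq, Fin.forall_fin_succ]
  simp [mul_comm]
  tauto

/-- Projecting to `ℂP²` gives `b = b'`. Over a fixed `b`, the circle element relating the two
matrices must have trivial `j`-th phase; its other two phases are then conjugate, and it acts on `S³
⊂ ℂ²` by the scalar `phase k l θ (j + 1)`. `phase_pow_eq_one` and `exists_phase` identify these
scalars with the roots of unity. -/
theorem tube_eq_iff {k l : ℤ} (hkl : IsCoprime k l) {j : Fin 3} (hw : weight k l j ≠ 0) (g : SU3)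
    (b b' : E4) (x x' : S3) : (tube g j (b, x) : W k l) = (tube g j (b', x') : W k l) ↔
      b = b' ∧ SameOrbit (weight k l j).natAbs x x' := by
  have key : ∀ θ : ℝ, (tube g j (b, x') : Matrix (Fin 3) (Fin 3) ℂ) =
      tube g j (b, x) * Matrix.diagonal (phase k l θ) ↔
      blockMatrix x'.1 = blockMatrix x.1 * Matrix.diagonal
        ![phase k l θ (j + 1), phase k l θ (j + 2), phase k l θ j] := by
    intro θ
    rw [← block_eq_mul_diagonal_iff]
    change tubeMatrix g j (b, x'.1) = tubeMatrix g j (b, x.1) * _ ↔ _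
    rw [tubeMatrix_eq_base, tubeMatrix_eq_base, mul_assoc]
    constructor
    · intro h
      have h' := congrArg (fun M => ((tubeBase g j b)⁻¹ : SU3).1 * M) h
      simp only [← mul_assoc] at h'
      rwa [← Submonoid.coe_mul, inv_mul_cancel, Submonoid.coe_one, one_mul, one_mul] at h'
    · intro h
      rw [h]
  constructor
  · intro h
    have hb : b = b' := linePoint_injective g j (by
      rw [← proj_tube k l g j (b, x), ← proj_tube k l g j (b', x'), h])
    subst hb
    obtain ⟨θ, hθ⟩ := (mk_eq_mk_iff k l _ _).1 h
    rw [key, block_mul_diagonal] at hθ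
    exact ⟨rfl, phase k l θ (j + 1), phase_pow_eq_one hθ.2.2.2.2 _, hθ.1, hθ.2.1⟩
  · rintro ⟨rfl, ζ, hζ, h1, h2⟩
    change cplx₁ x'.1 = ζ * cplx₁ x.1 at h1
    change cplx₂ x'.1 = ζ * cplx₂ x.1 at h2
    obtain ⟨θ, h0, hθ⟩ := exists_phase hkl hw hζ
    refine (mk_eq_mk_iff k l _ _).2 ⟨θ, ?_⟩
    rw [key, block_mul_diagonal]
    have h12 := phase_mul k l θ j
    have hcc := phase_mul_conj k l θ (j + 1)
    rw [h0, hθ, one_mul] at h12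
    rw [hθ] at hcc
    have hconj : phase k l θ (j + 2) = conj ζ := by
      have hζ0 : ζ ≠ 0 := left_ne_zero_of_mul_eq_one hcc
      exact mul_left_cancel₀ hζ0 (h12.trans hcc.symm)
    refine ⟨?_, ?_, ?_, ?_, h0⟩
    · simpa [hθ] using h1
    · simpa [hθ] using h2
    · simp [hconj, h1]
    · simp [hconj, h2]

/-- A special unitary matrix has `star M = M.adjugate`, which expresses the last row and the second
column through the first column. -/
theorem eq_blockMatrix_of_mem {M : Matrix (Fin 3) (Fin 3) ℂ}
    (hM : M ∈ Matrix.specialUnitaryGroup (Fin 3) ℂ) (h0 : M 0 2 = 0) (h1 : M 1 2 = 0)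
    (h2 : M 2 2 = 1) : ∃ x : S3, M = blockMatrix x.1 := by
  obtain ⟨hu, hdet⟩ := Matrix.mem_specialUnitaryGroup_iff.1 hM
  have hadj : star M = M.adjugate := by
    have h := Matrix.mul_adjugate M
    rw [hdet, one_smul] at h
    calc star M = star M * (M * M.adjugate) := by rw [h, mul_one]
      _ = M.adjugate := by rw [← mul_assoc, Matrix.mem_unitaryGroup_iff'.1 hu, one_mul]
  have e : ∀ i j, conj (M j i) = M.adjugate i j := fun i j => by
    rw [← hadj, Matrix.star_apply]
    rfl
  rw [Matrix.adjugate_fin_three] at e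
  have e00 := e 0 0
  have e01 := e 0 1
  have e02 := e 0 2
  have e12 := e 1 2
  have e10 := e 1 0
  simp [h0, h1, h2] at e00 e01 e02 e12 e10
  have hn : (M 0 0) * conj (M 0 0) + M 1 0 * conj (M 1 0) = 1 := by
    have := congrFun (congrFun (Matrix.mem_unitaryGroup_iff'.1 hu) 0) 0
    rw [star_mul_apply, Fin.sum_univ_three] at this
    simp only [Matrix.one_apply_eq, e02, mul_zero, add_zero] at this
    linear_combination this
  let y : E4 := !₂[(M 0 0).re, (M 0 0).im, (M 1 0).re, (M 1 0).im]
  have y1 : cplx₁ y = M 0 0 := by apply Complex.ext <;> simp [cplx₁, y]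
  have y2 : cplx₂ y = M 1 0 := by apply Complex.ext <;> simp [cplx₂, y]
  have hy : ‖y‖ = 1 := by
    have h := cplx_norm y
    rw [y1, y2, hn] at h
    have h' : ‖y‖ ^ 2 = 1 := by exact_mod_cast h.symm
    exact (pow_eq_one_iff_of_nonneg (norm_nonneg y) two_ne_zero).1 h'
  refine ⟨⟨y, by simp [hy]⟩, ?_⟩
  rw [blockMatrix_eq, y1, y2]
  ext i j
  fin_cases i <;> fin_cases j <;> simp [h0, h1, h2, e00, e01, e02, e12]

/-- For `h` over the same point as the base frame `T`, the `j`-th column of `T⁻¹ h` is a unit scalar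
times a basis vector. As the `j`-th character of the circle is nontrivial, changing `h` within its
coset makes this scalar 1, and what is left is an element of `SU(2)`. -/
theorem range_tube {k l : ℤ} {j : Fin 3} (hw : weight k l j ≠ 0) (g : SU3) (b : E4) :
    Set.range (fun x : S3 => (tube g j (b, x) : W k l)) = fibre k l j (linePoint g j b) := by
  apply Set.Subset.antisymm
  · rintro _ ⟨x, rfl⟩
    exact proj_tube k l g j (b, x)
  · intro y hy
    obtain ⟨h, rfl⟩ := QuotientGroup.mk_surjective y
    obtain ⟨a, ha⟩ := (mem_fibre_iff k l j h _ _).1 hy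
    set T := tubeBase g j b with hT
    have hinv : ((invNorm b : ℝ) : ℂ) ≠ 0 := by exact_mod_cast (invNorm_pos b).ne'
    set a' : ℂ := a / invNorm b with ha'
    -- the `j`-th column of `T⁻¹ h` is a multiple of the basis vector
    have hTcol : ∀ i, (T : Matrix (Fin 3) (Fin 3) ℂ) i j =
        invNorm b * lineVec g j b i := fun i => by
      rw [hT, tubeBase, Submonoid.coe_mul, Matrix.mul_apply]
      simp only [Matrix.submatrix_apply, relabel_self, affineFrame_col, lineVec, Matrix.mulVec,
        dotProduct, Finset.mul_sum]
      exact Finset.sum_congr rfl fun r _ => by ring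
    have hcol : ∀ i, ((T⁻¹ * h : SU3) : Matrix (Fin 3) (Fin 3) ℂ) i j =
        a' * (1 : Matrix (Fin 3) (Fin 3) ℂ) i j := by
      intro i
      have hTT : ((T⁻¹ * T : SU3) : Matrix (Fin 3) (Fin 3) ℂ) i j =
          (1 : Matrix (Fin 3) (Fin 3) ℂ) i j := by rw [inv_mul_cancel]; rfl
      rw [← hTT, Submonoid.coe_mul, Submonoid.coe_mul, Matrix.mul_apply, Matrix.mul_apply,
        Finset.mul_sum]
      refine Finset.sum_congr rfl fun r _ => ?_
      rw [ha, hTcol, ha']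
      field_simp
    have hnorm : a' * conj a' = 1 := by
      have hu := Matrix.mem_unitaryGroup_iff'.1
        (Matrix.mem_specialUnitaryGroup_iff.1 (T⁻¹ * h).2).1
      have := congrFun (congrFun hu j) j
      rw [star_mul_apply, Finset.sum_eq_single j] at this
      · rw [hcol, Matrix.one_apply_eq, mul_one] at this
        rw [mul_comm]
        exact this
      · intro r _ hr
        rw [hcol, Matrix.one_apply_ne hr, mul_zero, mul_zero]
      · simp
    obtain ⟨θ, hθ⟩ : ∃ θ : ℝ, a' * phase k l θ j = 1 := by
      have habs : ‖a'‖ = 1 := by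
        rw [Complex.mul_conj] at hnorm
        have h' : Complex.normSq a' = 1 := by exact_mod_cast hnorm
        rw [Complex.normSq_eq_norm_sq] at h'
        exact (pow_eq_one_iff_of_nonneg (norm_nonneg a') two_ne_zero).1 h'
      have hwC : (weight k l j : ℂ) ≠ 0 := by exact_mod_cast hw
      refine ⟨-Complex.arg a' / weight k l j, ?_⟩
      have h1 := Complex.norm_mul_exp_arg_mul_I a'
      rw [habs, Complex.ofReal_one, one_mul] at h1
      nth_rewrite 1 [← h1]
      rw [phase, ← Complex.exp_add, ← Complex.exp_zero]
      congr 1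
      push_cast
      field_simp
      ring
    set δ : SU3 := ⟨Matrix.diagonal (phase k l θ), diagonal_phase_mem k l θ⟩ with hδ
    have hcol' : ∀ r, ((T⁻¹ * h * δ : SU3) : Matrix (Fin 3) (Fin 3) ℂ)
        ((relabel j).symm r) ((relabel j).symm 2) = (1 : Matrix (Fin 3) (Fin 3) ℂ) r 2 := by
      intro r
      have h2 : (relabel j).symm 2 = j := by rw [Equiv.symm_apply_eq, relabel_self]
      have h3 : (1 : Matrix (Fin 3) (Fin 3) ℂ) ((relabel j).symm r) j =
          (1 : Matrix (Fin 3) (Fin 3) ℂ) r 2 := by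
        simp only [Matrix.one_apply, Equiv.symm_apply_eq, relabel_self]
      rw [h2, Submonoid.coe_mul, hδ, Matrix.mul_diagonal, hcol, mul_right_comm, hθ, one_mul, h3]
    obtain ⟨x, hx⟩ := eq_blockMatrix_of_mem
      (submatrix_equiv_mem (relabel j).symm (T⁻¹ * h * δ).2)
      (by simpa using hcol' 0) (by simpa using hcol' 1) (by simpa using hcol' 2)
    refine ⟨x, ((mk_eq_mk_iff k l h (tube g j (b, x))).2 ⟨θ, ?_⟩).symm⟩
    change tubeMatrix g j (b, x.1) = _
    rw [tubeMatrix_eq_base, ← hx, ← hT, Matrix.submatrix_submatrix]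
    simp only [Equiv.symm_comp_self, Matrix.submatrix_id_id]
    rw [← Submonoid.coe_mul, mul_assoc, mul_inv_cancel_left]
    rfl

/-! ### The fibres form smooth families of space forms -/

instance fact_finrank_four :
    Fact (Module.finrank ℝ (EuclideanSpace ℝ (Fin (3 + 1))) = 3 + 1) :=
  ⟨finrank_euclideanSpace_fin⟩

theorem eq_cyclic (r i : Fin 3) : r = i ∨ r = i + 1 ∨ r = i + 2 := by
  revert r i; decide

theorem sign_relabel (i j : Fin 3) :
    Equiv.Perm.sign ((relabel i).trans (relabel j).symm) = 1 := by
  revert i j; decide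

/-- Rows and columns are permuted differently here, so the determinant changes by a sign; this sign
is 1 because cyclic permutations of three indices are even. -/
theorem submatrix_relabel_mem (i j : Fin 3) {M : Matrix (Fin 3) (Fin 3) ℂ}
    (hM : M ∈ Matrix.specialUnitaryGroup (Fin 3) ℂ) :
    M.submatrix (relabel i) (relabel j) ∈ Matrix.specialUnitaryGroup (Fin 3) ℂ := by
  rw [Matrix.mem_specialUnitaryGroup_iff, Matrix.mem_unitaryGroup_iff] at hM ⊢
  constructor
  · rw [Matrix.star_eq_conjTranspose, Matrix.conjTranspose_submatrix, Matrix.submatrix_mul_equiv,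
      ← Matrix.star_eq_conjTranspose, hM.1, Matrix.submatrix_one_equiv]
  · have h : M.submatrix (relabel i) (relabel j) =
        (M.submatrix (relabel j) (relabel j)).submatrix ((relabel i).trans (relabel j).symm) id := by
      ext r s
      simp
    rw [h, Matrix.det_permute, Matrix.det_submatrix_equiv_self, hM.2, sign_relabel]
    simp

/-- Some homogeneous coordinate `v i` is nonzero. The affine section in that chart, with rows
relabelled from `i` and columns from `j`, has `j`-th column proportional to `v`. The frame `g`
centres the chart at `x`, so one type of chart suffices. -/
theorem exists_linePoint_eq (j : Fin 3) (x : CP2) : ∃ g : SU3, linePoint g j 0 = x := by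
  induction x using Projectivization.ind with
  | h v hv =>
    obtain ⟨i, hi⟩ := Function.ne_iff.1 hv
    simp only [Pi.zero_apply] at hi
    let z₁ := v (i + 1) / v i
    let z₂ := v (i + 2) / v i
    let b : E4 := !₂[z₁.re, z₁.im, z₂.re, z₂.im]
    have b1 : cplx₁ b = z₁ := by apply Complex.ext <;> simp [cplx₁, b]
    have b2 : cplx₂ b = z₂ := by apply Complex.ext <;> simp [cplx₂, b]
    refine ⟨⟨_, submatrix_relabel_mem i j (affineFrame_mem b)⟩, ?_⟩
    rw [linePoint, Projectivization.mk_eq_mk_iff']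
    refine ⟨invNorm b / v i, ?_⟩
    funext r
    have h0 : (fun s => affineVec 0 (relabel j s)) = Pi.single j 1 := by
      funext s
      rcases eq_cyclic s j with rfl | rfl | rfl <;> simp [affineVec]
    rw [lineVec, h0, Matrix.mulVec_single_one]
    simp only [Matrix.col_apply, Matrix.submatrix_apply, relabel_self, affineFrame_col]
    rcases eq_cyclic r i with rfl | rfl | rfl <;> simp [affineVec, b1, b2, z₁, z₂] <;> field_simp

theorem contDiff_affineVec (i : Fin 3) : ContDiff ℝ ∞ (fun b => affineVec b i) := by
  fin_cases i
  · exact contDiff_cplx₁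
  · exact contDiff_cplx₂
  · exact contDiff_const

theorem contDiff_lineVec (g : SU3) (j i : Fin 3) : ContDiff ℝ ∞ (fun b => lineVec g j b i) := by
  simp only [lineVec, Matrix.mulVec, dotProduct]
  exact ContDiff.sum fun r _ => contDiff_const.mul (contDiff_affineVec _)

theorem isCP2Chart_lineVec (g : SU3) (j : Fin 3) :
    IsCP2Chart (lineVec g j) (linePoint g j) Set.univ where
  isOpen := isOpen_univ
  smooth := (contDiff_pi.2 fun i => contDiff_lineVec g j i).contDiffOn
  eq_mk b _ := ⟨lineVec_ne_zero g j b, rfl⟩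
  injOn := (linePoint_injective g j).injOn
  immersive := by
    rintro b - v ⟨c, hc⟩
    have hd : ∀ i, DifferentiableAt ℝ (fun b => lineVec g j b i) b := fun i =>
      (contDiff_lineVec g j i).differentiable (by simp) b
    have hi : ∀ i, fderiv ℝ (fun b => lineVec g j b i) b v = c * lineVec g j b i := fun i => by
      have h := congrFun hc i
      have hp : HasFDerivAt (lineVec g j)
          (ContinuousLinearMap.pi fun i => fderiv ℝ (fun b => lineVec g j b i) b) b :=
        hasFDerivAt_pi.2 fun i => (hd i).hasFDerivAt
      rwa [hp.fderiv, ContinuousLinearMap.coe_pi'] at h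
    have key : ∀ r, fderiv ℝ (fun b => affineVec b (relabel j r)) b v =
        c * affineVec b (relabel j r) := by
      intro r
      have h1 : ∀ b, affineVec b (relabel j r) =
          ∑ s, (star (g : Matrix (Fin 3) (Fin 3) ℂ)) r s * lineVec g j b s := fun b =>
        (congrFun (star_mulVec_lineVec g j b) r).symm
      simp only [h1]
      rw [fderiv_fun_sum fun s _ => (hd s).const_mul _, sum_apply, Finset.mul_sum]
      refine Finset.sum_congr rfl fun s _ => ?_
      rw [fderiv_const_mul (hd s), smul_apply, hi, smul_eq_mul]
      ring
    have h0 := key j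
    have h1 := key (j + 1)
    have h2 := key (j + 2)
    simp only [relabel_self, relabel_add_one, relabel_add_two] at h0 h1 h2
    -- The coordinate normalised to 1 has derivative zero, so the derivative has no component along
    -- the line.
    have hc0 : c = 0 := by simpa [affineVec] using h0.symm
    rw [hc0, zero_mul] at h1 h2
    refine cplx_ext ?_ ?_
    · rw [cplx₁_zero, ← fderiv_cplx₁ b v]
      exact h1
    · rw [cplx₂_zero, ← fderiv_cplx₂ b v]
      exact h2

/-- The inclusion `ℝ⁴ × S³ → ℝ⁴ × ℝ⁴`. -/
def tubeIncl (z : E4 × S3) : E4 × E4 := (z.1, z.2.1)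

theorem contMDiff_tubeIncl :
    ContMDiff ((𝓘(ℝ, E4)).prod (𝓡 3)) 𝓘(ℝ, E4 × E4) ∞ tubeIncl :=
  contMDiff_fst.prodMk_space
    ((contMDiff_coe_sphere (n := 3) (E := EuclideanSpace ℝ (Fin (3 + 1)))).comp contMDiff_snd)

theorem tube_apply (g : SU3) (j i i' : Fin 3) :
    (fun z => (tube g j z : Matrix (Fin 3) (Fin 3) ℂ) i i') =
      (fun z => tubeMatrix g j z i i') ∘ tubeIncl := rfl

theorem contMDiff_tube (g : SU3) (j i i' : Fin 3) :
    ContMDiff ((𝓘(ℝ, E4)).prod (𝓡 3)) 𝓘(ℝ, ℂ) ∞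
      (fun z => (tube g j z : Matrix (Fin 3) (Fin 3) ℂ) i i') :=
  (contDiff_tubeMatrix g j i i').contMDiff.comp contMDiff_tubeIncl

theorem mfderiv_tube (g : SU3) (j i i' : Fin 3) (z : E4 × S3)
    (v : TangentSpace ((𝓘(ℝ, E4)).prod (𝓡 3)) z) :
    mfderiv ((𝓘(ℝ, E4)).prod (𝓡 3)) 𝓘(ℝ, ℂ)
      (fun z => (tube g j z : Matrix (Fin 3) (Fin 3) ℂ) i i') z v =
    fderiv ℝ (fun z => tubeMatrix g j z i i') (z.1, z.2.1)
      (mfderiv ((𝓘(ℝ, E4)).prod (𝓡 3)) 𝓘(ℝ, E4 × E4) tubeIncl z v) := by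
  have h1 : MDifferentiableAt 𝓘(ℝ, E4 × E4) 𝓘(ℝ, ℂ) (fun z => tubeMatrix g j z i i')
      (tubeIncl z) :=
    ((contDiff_tubeMatrix g j i i').differentiable (by simp) _).mdifferentiableAt
  have h2 := contMDiff_tubeIncl.mdifferentiableAt (x := z) (by simp)
  rw [tube_apply, mfderiv_comp z h1 h2, mfderiv_eq_fderiv]
  rfl

theorem mfderiv_tubeIncl_fst (z : E4 × S3) (v : TangentSpace ((𝓘(ℝ, E4)).prod (𝓡 3)) z) :
    (show E4 × E4 from mfderiv ((𝓘(ℝ, E4)).prod (𝓡 3)) 𝓘(ℝ, E4 × E4) tubeIncl z v).1 = v.1 := by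
  have h2 := (contMDiff_tubeIncl.mdifferentiableAt (x := z) (by simp)).hasMFDerivAt
  have h1 : HasMFDerivAt 𝓘(ℝ, E4 × E4) 𝓘(ℝ, E4) (Prod.fst : E4 × E4 → E4) (tubeIncl z)
      (ContinuousLinearMap.fst ℝ E4 E4) := hasFDerivAt_fst.hasMFDerivAt
  have h3 := h1.comp z h2
  have h4 := hasMFDerivAt_fst (I := 𝓘(ℝ, E4)) (I' := 𝓡 3) z
  have h5 := hasMFDerivAt_unique h3 h4
  exact congrArg (fun L => L v) h5

theorem mfderiv_tubeIncl_snd (z : E4 × S3) (v : TangentSpace ((𝓘(ℝ, E4)).prod (𝓡 3)) z) :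
    (show E4 × E4 from mfderiv ((𝓘(ℝ, E4)).prod (𝓡 3)) 𝓘(ℝ, E4 × E4) tubeIncl z v).2 =
      mvfderiv (𝓡 3) ((↑) : S3 → EuclideanSpace ℝ (Fin (3 + 1))) z.2 v.2 := by
  have h2 := (contMDiff_tubeIncl.mdifferentiableAt (x := z) (by simp)).hasMFDerivAt
  have h1 : HasMFDerivAt 𝓘(ℝ, E4 × E4) 𝓘(ℝ, E4) (Prod.snd : E4 × E4 → E4) (tubeIncl z)
      (ContinuousLinearMap.snd ℝ E4 E4) := hasFDerivAt_snd.hasMFDerivAt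
  have h3 := h1.comp z h2
  have h4 := hasMFDerivAt_snd (I := 𝓘(ℝ, E4)) (I' := 𝓡 3) z
  have h6 := ((contMDiff_coe_sphere (m := 1) (n := 3)
    (E := EuclideanSpace ℝ (Fin (3 + 1)))).mdifferentiableAt (x := z.2) (by simp)).hasMFDerivAt
  have h5 := hasMFDerivAt_unique h3 (h6.comp z h4)
  exact congrArg (fun L => L v) h5

theorem isSpaceFormFamily_fibre {k l : ℤ} (hkl : IsCoprime k l) {j : Fin 3}
    (hw : weight k l j ≠ 0) :
    IsSpaceFormFamily k l (weight k l j).natAbs (fibre k l j) := by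
  refine ⟨fun x y hxy => ?_, fun x₀ => ?_⟩
  · exact Disjoint.preimage _ (Set.disjoint_singleton.2 hxy)
  · obtain ⟨g, hg⟩ := exists_linePoint_eq j x₀
    refine ⟨lineVec g j, linePoint g j, Set.univ, tube g j, isCP2Chart_lineVec g j,
      ⟨0, trivial, hg⟩, fun i i' => (contMDiff_tube g j i i').contMDiffOn, ?_,
      fun b _ b' _ x x' => tube_eq_iff hkl hw g b b' x x', fun b _ => range_tube hw g b⟩
    intro z _ v hv
    have hx : ‖z.2.1‖ = 1 := norm_eq_of_mem_sphere z.2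
    have h1 := mfderiv_tubeIncl_fst z v
    have h2 := mfderiv_tubeIncl_snd z v
    have hξ := tubeMatrix_immersive hw g (tube g j z) hx rfl _ v
      (mfderiv ((𝓘(ℝ, E4)).prod (𝓡 3)) 𝓘(ℝ, E4 × E4) tubeIncl z v)
      (fun i i' => mfderiv_tube g j i i' z v) (by
        -- The tangent space of the sphere is the orthogonal complement of the position vector,
        -- which is the hypothesis needed on the second component.
        have hr : mvfderiv (𝓡 3) ((↑) : S3 → EuclideanSpace ℝ (Fin (3 + 1))) z.2 v.2 ∈
            (ℝ ∙ (z.2 : EuclideanSpace ℝ (Fin (3 + 1))))ᗮ := by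
          rw [← range_mvfderiv_subtypeVal (n := 3) (E := EuclideanSpace ℝ (Fin (3 + 1)))]
          exact ⟨v.2, rfl⟩
        rw [← h2] at hr
        exact Submodule.mem_orthogonal_singleton_iff_inner_right.1 hr) hv
    rw [hξ] at h1 h2
    refine Prod.ext h1.symm ?_
    apply injective_mvfderiv_subtypeVal_sphere (n := 3) (E := EuclideanSpace ℝ (Fin (3 + 1))) z.2
    rw [← h2]
    exact (map_zero _).symm

/-! ### The fibres are embedded submanifolds -/

/-- The last four coordinates. -/
def normalPart (z : E7) : E4 := !₂[z 3, z 4, z 5, z 6]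

/-- The central projection of the first three coordinates to the upper hemisphere. -/
def hemisphere (z : E7) : E4 :=
  (√(1 + z 0 ^ 2 + z 1 ^ 2 + z 2 ^ 2))⁻¹ • !₂[1, z 0, z 1, z 2]

theorem norm_hemisphere (z : E7) : ‖hemisphere z‖ = 1 := by
  have hpos : 0 < 1 + z 0 ^ 2 + z 1 ^ 2 + z 2 ^ 2 := by positivity
  have h : ‖(!₂[1, z 0, z 1, z 2] : E4)‖ = √(1 + z 0 ^ 2 + z 1 ^ 2 + z 2 ^ 2) := by
    rw [EuclideanSpace.norm_eq]
    simp [Fin.sum_univ_four]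
  rw [hemisphere, norm_smul, h, norm_inv, Real.norm_of_nonneg (Real.sqrt_nonneg _)]
  exact inv_mul_cancel₀ (Real.sqrt_pos.2 hpos).ne'

theorem hemisphere_zero_pos (z : E7) : 0 < hemisphere z 0 := by
  simp only [hemisphere, PiLp.smul_apply, smul_eq_mul]
  simp
  positivity

theorem hemisphere_succ (z : E7) :
    hemisphere z 1 = z 0 * hemisphere z 0 ∧ hemisphere z 2 = z 1 * hemisphere z 0 ∧
      hemisphere z 3 = z 2 * hemisphere z 0 := by
  simp [hemisphere, mul_comm]

theorem contDiff_normalPart : ContDiff ℝ ∞ normalPart := by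
  rw [contDiff_euclidean]
  intro i
  fin_cases i <;> simp [normalPart] <;> fun_prop

theorem contDiff_hemisphere : ContDiff ℝ ∞ hemisphere := by
  refine ContDiff.smul (ContDiff.inv (ContDiff.sqrt (by fun_prop) ?_) ?_) ?_
  · intro z; positivity
  · intro z; positivity
  · rw [contDiff_euclidean]
    intro i
    fin_cases i <;> simp <;> fun_prop

theorem inner_hemisphere (z v : E7) : inner ℝ (hemisphere z) (fderiv ℝ hemisphere z v) = 0 := by
  have hd := (contDiff_hemisphere.differentiable (by simp) z).hasFDerivAt
  have h1 := (hd.inner ℝ hd).fderiv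
  have h2 : (fun z => inner ℝ (hemisphere z) (hemisphere z)) = fun _ => (1 : ℝ) := by
    funext z
    rw [real_inner_self_eq_norm_sq, norm_hemisphere, one_pow]
  rw [h2] at h1
  have h3 := congrArg (fun L => L v) h1
  simp [fderivInnerCLM_apply] at h3
  have h4 := real_inner_comm (hemisphere z) (fderiv ℝ hemisphere z v)
  linarith

theorem fderiv_coord {f : E7 → E4} {z : E7} (hf : DifferentiableAt ℝ f z) (v : E7) (i : Fin 4) :
    fderiv ℝ (fun y => f y i) z v = fderiv ℝ f z v i := by
  have h := (EuclideanSpace.proj i : E4 →L[ℝ] ℝ).hasFDerivAt.comp z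
    hf.hasFDerivAt
  have h' : HasFDerivAt (fun y => f y i)
    ((EuclideanSpace.proj i : E4 →L[ℝ] ℝ).comp (fderiv ℝ f z)) z := h
  rw [h'.fderiv]
  rfl

theorem fderiv_proj (z v : E7) (i : Fin 7) : fderiv ℝ (fun y : E7 => y i) z v = v i := by
  have h : HasFDerivAt (fun y : E7 => y i)
    (EuclideanSpace.proj i : E7 →L[ℝ] ℝ) z :=
    (EuclideanSpace.proj i : E7 →L[ℝ] ℝ).hasFDerivAt
  rw [h.fderiv]
  rfl

/-- The central projection is inverted by the ratios of the last three coordinates to the positive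
first one, so its derivative is injective on the first three variables. -/
theorem eq_zero_of_fderiv_chart {z v : E7} (h₁ : fderiv ℝ normalPart z v = 0)
    (h₂ : fderiv ℝ hemisphere z v = 0) : v = 0 := by
  have hn := contDiff_normalPart.differentiable (by simp) z
  have hh := contDiff_hemisphere.differentiable (by simp) z
  have hcn : ∀ i, fderiv ℝ (fun y => normalPart y i) z v = 0 := fun i => by
    rw [fderiv_coord hn, h₁]
    rfl
  have hch : ∀ i, fderiv ℝ (fun y => hemisphere y i) z v = 0 := fun i => by
    rw [fderiv_coord hh, h₂]
    rfl
  have h3 : v 3 = 0 := by rw [← fderiv_proj z]; exact hcn 0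
  have h4 : v 4 = 0 := by rw [← fderiv_proj z]; exact hcn 1
  have h5 : v 5 = 0 := by rw [← fderiv_proj z]; exact hcn 2
  have h6 : v 6 = 0 := by rw [← fderiv_proj z]; exact hcn 3
  have hd0 : DifferentiableAt ℝ (fun y => hemisphere y 0) z :=
    (contDiff_euclidean.1 contDiff_hemisphere 0).differentiable (by simp) z
  have hp : ∀ (i : Fin 7), fderiv ℝ (fun y : E7 => y i * hemisphere y 0) z v = 0 → v i = 0 := by
    intro i hi
    have hdi : DifferentiableAt ℝ (fun y : E7 => y i) z := by fun_prop
    rw [(hdi.hasFDerivAt.fun_mul hd0.hasFDerivAt).fderiv, add_apply, smul_apply, smul_apply,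
      hch 0, fderiv_proj, smul_zero, zero_add, smul_eq_mul] at hi
    exact (mul_eq_zero.1 hi).resolve_left (hemisphere_zero_pos z).ne'
  have h0 : v 0 = 0 := hp 0 (by
    rw [← hch 1]
    congr 2
    funext y
    exact (hemisphere_succ y).1.symm)
  have h1 : v 1 = 0 := hp 1 (by
    rw [← hch 2]
    congr 2
    funext y
    exact (hemisphere_succ y).2.1.symm)
  have h2 : v 2 = 0 := hp 2 (by
    rw [← hch 3]
    congr 2
    funext y
    exact (hemisphere_succ y).2.2.symm)
  ext i
  fin_cases i
  exacts [h0, h1, h2, h3, h4, h5, h6]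

theorem exists_isolating_radius {p : ℕ} (hp : p ≠ 0) :
    ∃ ε > 0, ∀ ζ : ℂ, ζ ^ p = 1 → ‖ζ - 1‖ < ε → ζ = 1 := by
  have hfin : Set.Finite {ζ : ℂ | ζ ^ p = 1 ∧ ζ ≠ 1} := by
    refine Set.Finite.subset (Polynomial.nthRootsFinset p (1 : ℂ)).finite_toSet fun ζ hζ => ?_
    exact (Polynomial.mem_nthRootsFinset (Nat.pos_of_ne_zero hp) _).2 hζ.1
  obtain ⟨ε, hε, h⟩ := Metric.isOpen_iff.1 hfin.isClosed.isOpen_compl 1 (by simp)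
  refine ⟨ε, hε, fun ζ hζ hlt => ?_⟩
  by_contra hne
  exact h (by rwa [Metric.mem_ball, dist_eq_norm]) ⟨hζ, hne⟩

/-- `y - x` is `ζ - 1` times a unit vector. This makes distances within an orbit depend on `ζ`
alone: it gives injectivity on small sets, and freeness of the action. -/
theorem norm_sub_of_orbit {x y : E4} {ζ : ℂ} (hx : ‖x‖ = 1) (h₁ : cplx₁ y = ζ * cplx₁ x)
    (h₂ : cplx₂ y = ζ * cplx₂ x) : ‖ζ - 1‖ = ‖y - x‖ := by
  have e1 : cplx₁ (y - x) = (ζ - 1) * cplx₁ x := by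
    rw [sub_eq_add_neg, ← neg_one_smul ℝ, cplx₁_add, cplx₁_smul, h₁]
    push_cast; ring
  have e2 : cplx₂ (y - x) = (ζ - 1) * cplx₂ x := by
    rw [sub_eq_add_neg, ← neg_one_smul ℝ, cplx₂_add, cplx₂_smul, h₂]
    push_cast; ring
  have h := cplx_norm (y - x)
  have h' := cplx_norm x
  rw [hx] at h'
  have h3 : ((‖ζ - 1‖ ^ 2 : ℝ) : ℂ) = ((‖y - x‖ ^ 2 : ℝ) : ℂ) := by
    rw [← h, e1, e2, ← Complex.normSq_eq_norm_sq, ← Complex.mul_conj]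
    simp only [map_mul]
    simp only [one_pow, Complex.ofReal_one] at h'
    linear_combination (-(ζ - 1) * conj (ζ - 1)) * h'
  have h4 : ‖ζ - 1‖ ^ 2 = ‖y - x‖ ^ 2 := by exact_mod_cast h3
  exact (sq_eq_sq₀ (norm_nonneg _) (norm_nonneg _)).1 h4

/-- Coordinates on `W_{k,l}` around `[g]` adapted to the `j`-th projection. -/
def fibreChart (g : SU3) (j : Fin 3) (z : E7) : SU3 :=
  tube g j (normalPart z, ⟨hemisphere z, by simp [norm_hemisphere]⟩)

theorem fderiv_fibreChart (g : SU3) (j i i' : Fin 3) (z v : E7) :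
    fderiv ℝ (fun y => (fibreChart g j y : Matrix (Fin 3) (Fin 3) ℂ) i i') z v =
      fderiv ℝ (fun w => tubeMatrix g j w i i') (normalPart z, hemisphere z)
        (fderiv ℝ normalPart z v, fderiv ℝ hemisphere z v) := by
  have hn := (contDiff_normalPart.differentiable (by simp) z).hasFDerivAt
  have hh := (contDiff_hemisphere.differentiable (by simp) z).hasFDerivAt
  have ht := ((contDiff_tubeMatrix g j i i').differentiable (by simp)
    (normalPart z, hemisphere z)).hasFDerivAt
  exact congrArg (fun L => L v) (HasFDerivAt.comp z ht (hn.prodMk hh)).fderiv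

theorem contDiff_fibreChart (g : SU3) (j i i' : Fin 3) :
    ContDiff ℝ ∞ (fun y => (fibreChart g j y : Matrix (Fin 3) (Fin 3) ℂ) i i') :=
  (contDiff_tubeMatrix g j i i').comp (contDiff_normalPart.prodMk contDiff_hemisphere)

theorem exists_isChart_fibreChart {k l : ℤ} (hkl : IsCoprime k l) {j : Fin 3}
    (hw : weight k l j ≠ 0) (g : SU3) :
    ∃ U : Set E7, (0 : E7) ∈ U ∧ IsChart k l (fibreChart g j) U := by
  obtain ⟨ε, hε, hroot⟩ := exists_isolating_radius (Int.natAbs_ne_zero.2 hw)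
  -- Points of the `ε / 2`-ball are less than `ε` apart, hence cannot differ by a nontrivial root of
  -- unity. No bound on the normal coordinates is needed.
  refine ⟨{z | ‖hemisphere z - hemisphere 0‖ < ε / 2}, by simpa using hε, ?_, ?_, ?_, ?_⟩
  · have hc := contDiff_hemisphere.continuous
    exact isOpen_lt (by fun_prop) continuous_const
  · exact fun i i' => (contDiff_fibreChart g j i i').contDiffOn
  · intro z _ v hv
    have h := tubeMatrix_immersive hw g (fibreChart g j z) (norm_hemisphere z) rfl _ v
      (fderiv ℝ normalPart z v, fderiv ℝ hemisphere z v)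
      (fun i i' => fderiv_fibreChart g j i i' z v) (inner_hemisphere z v) hv
    exact eq_zero_of_fderiv_chart (congrArg Prod.fst h) (congrArg Prod.snd h)
  · intro z hz z' hz' h
    obtain ⟨hn, ζ, hζ, h1, h2⟩ := (tube_eq_iff hkl hw g _ _ _ _).1 h
    have hnorm := norm_sub_of_orbit (norm_hemisphere z) h1 h2
    have hlt : ‖hemisphere z' - hemisphere z‖ < ε := by
      have hz1 : ‖hemisphere z - hemisphere 0‖ < ε / 2 := hz
      have hz2 : ‖hemisphere z' - hemisphere 0‖ < ε / 2 := hz'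
      calc ‖hemisphere z' - hemisphere z‖
          = ‖(hemisphere z' - hemisphere 0) - (hemisphere z - hemisphere 0)‖ := by congr 1; abel
        _ ≤ _ := norm_sub_le _ _
        _ < ε := by linarith
    have hζ1 := hroot ζ hζ (by rwa [hnorm])
    rw [hζ1, sub_self, norm_zero] at hnorm
    have heq : hemisphere z' = hemisphere z := sub_eq_zero.1 (norm_eq_zero.1 hnorm.symm)
    have hpos := (hemisphere_zero_pos z).ne'
    obtain ⟨a0, a1, a2⟩ := hemisphere_succ z
    obtain ⟨b0, b1, b2⟩ := hemisphere_succ z'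
    rw [heq] at b0 b1 b2
    have hn' : ∀ i, normalPart z i = normalPart z' i := fun i => by
      have : normalPart z = normalPart z' := hn
      rw [this]
    ext i
    fin_cases i
    · exact mul_right_cancel₀ hpos (a0.symm.trans b0)
    · exact mul_right_cancel₀ hpos (a1.symm.trans b1)
    · exact mul_right_cancel₀ hpos (a2.symm.trans b2)
    · exact hn' 0
    · exact hn' 1
    · exact hn' 2
    · exact hn' 3

theorem affineFrame_zero : affineFrame 0 = 1 := by
  ext i i'
  fin_cases i <;> fin_cases i' <;> simp [affineFrame, frameMatrix, invNorm]

theorem fibreChart_zero (g : SU3) (j : Fin 3) : fibreChart g j 0 = g := by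
  have hn : normalPart 0 = 0 := by
    ext i
    fin_cases i <;> simp [normalPart]
  have hb : blockMatrix (hemisphere 0) = 1 := by
    have h1 : cplx₁ (hemisphere 0) = 1 := by
      apply Complex.ext <;> simp [cplx₁, hemisphere]
    have h2 : cplx₂ (hemisphere 0) = 0 := by
      apply Complex.ext <;> simp [cplx₂, hemisphere]
    rw [blockMatrix_eq, h1, h2]
    ext i i'
    fin_cases i <;> fin_cases i' <;> simp
  apply Subtype.ext
  change tubeMatrix g j (normalPart 0, hemisphere 0) = g
  rw [tubeMatrix, hn, affineFrame_zero, hb, one_mul, Matrix.submatrix_one_equiv, mul_one]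

theorem normalPart_eq_zero_iff (z : E7) :
    normalPart z = 0 ↔ z 3 = 0 ∧ z 4 = 0 ∧ z 5 = 0 ∧ z 6 = 0 := by
  constructor
  · intro h
    have hi : ∀ i, normalPart z i = 0 := fun i => by rw [h]; rfl
    exact ⟨hi 0, hi 1, hi 2, hi 3⟩
  · rintro ⟨h3, h4, h5, h6⟩
    ext i
    fin_cases i <;> simp [normalPart, h3, h4, h5, h6]

/-- In the coordinates `fibreChart g j` the projection becomes the last four coordinates followed by
an injective affine chart of `ℂP²`, so its fibres are coordinate slices. -/
theorem isEmbeddedThreefold_fibre {k l : ℤ} (hkl : IsCoprime k l) {j : Fin 3}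
    (hw : weight k l j ≠ 0) (x : CP2) : IsEmbeddedThreefold k l (fibre k l j x) := by
  intro y hy
  obtain ⟨g, rfl⟩ := QuotientGroup.mk_surjective y
  obtain ⟨U, h0, hU⟩ := exists_isChart_fibreChart hkl hw g
  have hproj : ∀ z, proj k l j (fibreChart g j z : W k l) = linePoint g j (normalPart z) :=
    fun z => proj_tube k l g j _
  have hn : normalPart 0 = 0 := (normalPart_eq_zero_iff 0).2 (by simp)
  have hx : x = linePoint g j 0 := by
    have h1 := hproj 0
    rw [fibreChart_zero, hn] at h1
    exact (show proj k l j (g : W k l) = x from hy).symm.trans h1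
  refine ⟨fibreChart g j, U, 0, hU, h0, by rw [fibreChart_zero], fun z _ => ?_⟩
  rw [← normalPart_eq_zero_iff]
  change proj k l j (fibreChart g j z : W k l) = x ↔ _
  rw [hproj, hx, (linePoint_injective g j).eq_iff]

/-! ### The second fundamental form in terms of a coframe -/

theorem one_add_one_le_infty : (1 : WithTop ℕ∞) + 1 ≤ ∞ := by
  rw [one_add_one_eq_two]
  exact WithTop.coe_le_coe.2 (le_top (a := (2 : ℕ∞)))

theorem two_le_infty : (2 : WithTop ℕ∞) ≤ ∞ := WithTop.coe_le_coe.2 (le_top (a := (2 : ℕ∞)))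

/-- The product rule applied to the metric `∑ s a • ηᵃ ⊗ ηᵃ`. The second term is `ηᵃ(p) dηᵃ(p, n)`;
the first is completed by `fderiv_coframe_comp` to the derivative of `ηᵃ(∂ₜu)` along `u`. -/
theorem christoffel_coframe {η : Fin 7 → E7 → E7 →L[ℝ] ℝ} {s : Fin 7 → ℝ} {y : E7}
    (hη : ∀ a, DifferentiableAt ℝ (η a) y) (p n : E7) :
    christoffel (fun y u v => ∑ a, s a * (η a y u * η a y v)) y p p n =
      ∑ a, s a * (fderiv ℝ (η a) y p p * η a y n +
        η a y p * (fderiv ℝ (η a) y p n - fderiv ℝ (η a) y n p)) := by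
  have hd : ∀ a (v w : E7), fderiv ℝ (fun y => η a y v) y w = fderiv ℝ (η a) y w v := by
    intro a v w
    have h := (hη a).hasFDerivAt.clm_apply (hasFDerivAt_const v y)
    rw [h.fderiv]
    simp
  have hdiff : ∀ a (v : E7), DifferentiableAt ℝ (fun y => η a y v) y := fun a v =>
    (hη a).clm_apply (differentiableAt_const v)
  have key : ∀ u v w : E7, fderiv ℝ (fun y => ∑ a, s a * (η a y u * η a y v)) y w =
      ∑ a, s a * (η a y u * fderiv ℝ (η a) y w v + η a y v * fderiv ℝ (η a) y w u) := by
    intro u v w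
    rw [fderiv_fun_sum fun a _ => ((hdiff a u).fun_mul (hdiff a v)).const_mul _, sum_apply]
    refine Finset.sum_congr rfl fun a _ => ?_
    rw [fderiv_const_mul ((hdiff a u).fun_mul (hdiff a v)), smul_apply,
      fderiv_fun_mul (hdiff a u) (hdiff a v), add_apply, smul_apply, smul_apply, hd, hd]
    simp only [smul_eq_mul]
  simp only [christoffel, key]
  rw [← Finset.sum_add_distrib, ← Finset.sum_sub_distrib, Finset.mul_sum]
  refine Finset.sum_congr rfl fun a _ => ?_
  ring

theorem fderiv_coframe_comp {η : E7 → E7 →L[ℝ] ℝ} {u : E3 → E7} {b t : E3}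
    (hη : DifferentiableAt ℝ η (u b)) (hu : ContDiffAt ℝ ∞ u b) :
    fderiv ℝ (fun b' => η (u b') (fderiv ℝ u b' t)) b t =
      fderiv ℝ η (u b) (fderiv ℝ u b t) (fderiv ℝ u b t) +
        η (u b) (fderiv ℝ (fderiv ℝ u) b t t) := by
  have h1 : HasFDerivAt (fun b' => η (u b')) _ b :=
    hη.hasFDerivAt.comp b (hu.differentiableAt (by simp)).hasFDerivAt
  have h2 : DifferentiableAt ℝ (fderiv ℝ u) b :=
    (hu.fderiv_right (m := 1) one_add_one_le_infty).differentiableAt (by simp)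
  have h3 := h2.hasFDerivAt.clm_apply (hasFDerivAt_const t b)
  have h4 := h1.clm_apply h3
  rw [h4.fderiv]
  simp [add_comm]

/-! ### The structure equations -/

section Structure

variable {ψ : E7 → SU3} {y : E7}

theorem pullMC_apply (ψ : E7 → SU3) (y v : E7) (i j : Fin 3) : pullMC ψ y i j v =
    ∑ r, conj ((ψ y : Matrix (Fin 3) (Fin 3) ℂ) r i) *
      fderiv ℝ (fun y => (ψ y : Matrix (Fin 3) (Fin 3) ℂ) r j) y v :=
  maurerCartan_apply _ _ _ _ _

theorem pullMC_skew (h : ∀ i j, ContDiffAt ℝ ∞ (fun y => (ψ y : Matrix (Fin 3) (Fin 3) ℂ) i j) y)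
    (i j : Fin 3) (v : E7) : pullMC ψ y i j v = -conj (pullMC ψ y j i v) := by
  have hd := fun i j => (h i j).differentiableAt (by simp)
  have h0 : (fun y => ∑ r, conj ((ψ y : Matrix (Fin 3) (Fin 3) ℂ) r i) *
      (ψ y : Matrix (Fin 3) (Fin 3) ℂ) r j) = fun _ => (1 : Matrix (Fin 3) (Fin 3) ℂ) i j := by
    funext y
    rw [← star_mul_apply,
      Matrix.mem_unitaryGroup_iff'.1 (Matrix.mem_specialUnitaryGroup_iff.1 (ψ y).2).1]
  have h1 := fderiv_conj_mul (f := fun r y => (ψ y : Matrix (Fin 3) (Fin 3) ℂ) r i)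
    (h := fun r y => (ψ y : Matrix (Fin 3) (Fin 3) ℂ) r j) (fun r => hd r i) (fun r => hd r j) v
  rw [h0, fderiv_const_apply, zero_apply, Finset.sum_add_distrib] at h1
  rw [pullMC_apply, pullMC_apply, map_sum]
  simp only [map_mul, Complex.conj_conj]
  linear_combination -h1

theorem contDiffAt_pullMC
    (h : ∀ i j, ContDiffAt ℝ ∞ (fun y => (ψ y : Matrix (Fin 3) (Fin 3) ℂ) i j) y) (i j : Fin 3) :
    ContDiffAt ℝ 1 (fun y => pullMC ψ y i j) y := by
  change ContDiffAt ℝ 1 (fun y => ∑ r, conj ((ψ y : Matrix (Fin 3) (Fin 3) ℂ) r i) •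
    fderiv ℝ (fun y => (ψ y : Matrix (Fin 3) (Fin 3) ℂ) r j) y) y
  refine ContDiffAt.sum fun r _ => ContDiffAt.fun_smul ?_ ((h r j).fderiv_right one_add_one_le_infty)
  exact (contDiff_conj.contDiffAt.comp y (h r i)).of_le (by simp)

theorem differentiableAt_pullMC
    (h : ∀ i j, ContDiffAt ℝ ∞ (fun y => (ψ y : Matrix (Fin 3) (Fin 3) ℂ) i j) y) (i j : Fin 3) :
    DifferentiableAt ℝ (fun y => pullMC ψ y i j) y :=
  (contDiffAt_pullMC h i j).differentiableAt (by simp)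

theorem fderiv_pullMC
    (h : ∀ i j, ContDiffAt ℝ ∞ (fun y => (ψ y : Matrix (Fin 3) (Fin 3) ℂ) i j) y) (i j : Fin 3)
    (p n : E7) : fderiv ℝ (fun y => pullMC ψ y i j) y p n = ∑ r,
      (conj ((ψ y : Matrix (Fin 3) (Fin 3) ℂ) r i) *
        fderiv ℝ (fderiv ℝ (fun y => (ψ y : Matrix (Fin 3) (Fin 3) ℂ) r j)) y p n +
      fderiv ℝ (fun y => (ψ y : Matrix (Fin 3) (Fin 3) ℂ) r j) y n *
        conj (fderiv ℝ (fun y => (ψ y : Matrix (Fin 3) (Fin 3) ℂ) r i) y p)) := by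
  have hd := fun i j => (h i j).differentiableAt (by simp)
  have hd2 : ∀ r, DifferentiableAt ℝ
      (fderiv ℝ (fun y => (ψ y : Matrix (Fin 3) (Fin 3) ℂ) r j)) y := fun r =>
    ((h r j).fderiv_right (m := 1) one_add_one_le_infty).differentiableAt (by simp)
  have e1 : fderiv ℝ (fun y => pullMC ψ y i j) y p n =
      fderiv ℝ (fun y => pullMC ψ y i j n) y p := by
    rw [((differentiableAt_pullMC h i j).hasFDerivAt.clm_apply (hasFDerivAt_const n y)).fderiv]
    simp
  rw [e1]
  simp only [pullMC_apply]
  rw [fderiv_conj_mul (f := fun r y => (ψ y : Matrix (Fin 3) (Fin 3) ℂ) r i)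
    (h := fun r y => fderiv ℝ (fun y => (ψ y : Matrix (Fin 3) (Fin 3) ℂ) r j) y n)
    (fun r => hd r i) (fun r => (hd2 r).clm_apply (differentiableAt_const n))]
  refine Finset.sum_congr rfl fun r _ => ?_
  rw [((hd2 r).hasFDerivAt.clm_apply (hasFDerivAt_const n y)).fderiv]
  simp

/-- The Maurer–Cartan equation `dΩ = -Ω ∧ Ω`. -/
theorem structure_equation
    (h : ∀ i j, ContDiffAt ℝ ∞ (fun y => (ψ y : Matrix (Fin 3) (Fin 3) ℂ) i j) y) (i j : Fin 3)
    (p n : E7) :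
    fderiv ℝ (fun y => pullMC ψ y i j) y p n - fderiv ℝ (fun y => pullMC ψ y i j) y n p =
      ∑ s, (pullMC ψ y i s n * pullMC ψ y s j p - pullMC ψ y i s p * pullMC ψ y s j n) := by
  have hsymm : ∀ r, fderiv ℝ (fderiv ℝ (fun y => (ψ y : Matrix (Fin 3) (Fin 3) ℂ) r j)) y p n =
      fderiv ℝ (fderiv ℝ (fun y => (ψ y : Matrix (Fin 3) (Fin 3) ℂ) r j)) y n p := fun r =>
    (h r j).isSymmSndFDerivAt (by simpa using two_le_infty) p n
  -- This is `(dψ)* dψ = (ψΩ)* ψΩ = Ω* Ω = -Ω Ω`, by unitarity and skewness. The second derivatives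
  -- of `ψ` cancel by symmetry.
  have key : ∀ v w : E7, ∑ r, fderiv ℝ (fun y => (ψ y : Matrix (Fin 3) (Fin 3) ℂ) r j) y w *
      conj (fderiv ℝ (fun y => (ψ y : Matrix (Fin 3) (Fin 3) ℂ) r i) y v) =
      -∑ s, pullMC ψ y i s v * pullMC ψ y s j w := by
    intro v w
    have e1 : ∀ r, conj (fderiv ℝ (fun y => (ψ y : Matrix (Fin 3) (Fin 3) ℂ) r i) y v) =
        -∑ s, conj ((ψ y : Matrix (Fin 3) (Fin 3) ℂ) r s) * pullMC ψ y i s v := by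
      intro r
      rw [mul_maurerCartan (ψ y) (fun i j => fderiv ℝ
        (fun y => (ψ y : Matrix (Fin 3) (Fin 3) ℂ) i j) y) r i v, map_sum, ← Finset.sum_neg_distrib]
      refine Finset.sum_congr rfl fun s _ => ?_
      rw [map_mul, pullMC_skew h i s v, mul_neg, neg_neg]
      rfl
    simp only [e1, pullMC_apply (j := j), Finset.mul_sum, mul_neg,
      Finset.sum_neg_distrib]
    rw [Finset.sum_comm]
    congr 1
    refine Finset.sum_congr rfl fun s _ => Finset.sum_congr rfl fun r _ => ?_
    ring
  rw [fderiv_pullMC h, fderiv_pullMC h, Finset.sum_add_distrib, Finset.sum_add_distrib, key, key,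
    Finset.sum_sub_distrib]
  simp only [hsymm]
  ring

end Structure

/-- The coframe as a linear function of the Maurer–Cartan form. -/
def coframeCLM (k l : ℤ) (a : Fin 7) :
    (Fin 3 → Fin 3 → E7 →L[ℝ] ℂ) →L[ℝ] (E7 →L[ℝ] ℝ) :=
  LinearMap.toContinuousLinearMap
    { toFun := fun Ω => coframe k l Ω a
      map_add' := fun Ω Ω' => by
        ext v
        fin_cases a <;> simp [coframe, Fin.sum_univ_three] <;> ring
      map_smul' := fun c Ω => by
        ext v
        fin_cases a <;> simp [coframe, Fin.sum_univ_three] <;> ring }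

theorem hasFDerivAt_coframe {ψ : E7 → SU3} {y : E7} (k l : ℤ)
    (h : ∀ i j, ContDiffAt ℝ ∞ (fun y => (ψ y : Matrix (Fin 3) (Fin 3) ℂ) i j) y) (a : Fin 7) :
    HasFDerivAt (fun y => coframe k l (pullMC ψ y) a)
      ((coframeCLM k l a).comp (ContinuousLinearMap.pi fun i => ContinuousLinearMap.pi fun j =>
        fderiv ℝ (fun y => pullMC ψ y i j) y)) y := by
  have h1 : HasFDerivAt (pullMC ψ) (ContinuousLinearMap.pi fun i => ContinuousLinearMap.pi fun j =>
        fderiv ℝ (fun y => pullMC ψ y i j) y) y :=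
    hasFDerivAt_pi.2 fun i => hasFDerivAt_pi.2 fun j => (differentiableAt_pullMC h i j).hasFDerivAt
  exact (coframeCLM k l a).hasFDerivAt.comp y h1

theorem fderiv_coframe {ψ : E7 → SU3} {y : E7} (k l : ℤ)
    (h : ∀ i j, ContDiffAt ℝ ∞ (fun y => (ψ y : Matrix (Fin 3) (Fin 3) ℂ) i j) y) (a : Fin 7)
    (p n : E7) : fderiv ℝ (fun y => coframe k l (pullMC ψ y) a) y p n =
      coframe k l (fun i j => fderiv ℝ (fun y => pullMC ψ y i j) y p) a n := by
  rw [(hasFDerivAt_coframe k l h a).fderiv]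
  rfl

/-! ### The fibres are minimal and associative -/

/-- The indices of the forms `e¹, …, e⁷` which do not vanish on the fibres of the `j`-th
projection. -/
def tangentIdx : Fin 3 → Fin 3 → Fin 7 := ![![1, 5, 3], ![2, 6, 3], ![0, 4, 3]]

/-- The scale factors of the coframe. -/
def scales (A B C D : ℝ) : Fin 7 → ℝ := ![A, B, C, D, A, B, C]

theorem scales_ne_zero {A B C D : ℝ} (hA : A ≠ 0) (hB : B ≠ 0) (hC : C ≠ 0) (hD : D ≠ 0)
    (a : Fin 7) : scales A B C D a ≠ 0 := by
  fin_cases a <;> simpa [scales]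

theorem metricChart_eq (k l : ℤ) (A B C D : ℝ) (ψ : E7 → SU3) :
    metricChart k l A B C D ψ = fun y u v => ∑ a, scales A B C D a ^ 2 *
      (coframe k l (pullMC ψ y) a u * coframe k l (pullMC ψ y) a v) := by
  funext y u v
  rw [metricChart, coframeInner_adaptedCoframe, coframeInner]
  refine Finset.sum_congr rfl fun a _ => ?_
  simp only [scaledCoframe, smul_apply, smul_eq_mul, scales]
  ring

theorem contDiffAt_of_isChart {k l : ℤ} {ψ : E7 → SU3} {U : Set E7} (h : IsChart k l ψ U)
    {y : E7} (hy : y ∈ U) (i j : Fin 3) :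
    ContDiffAt ℝ ∞ (fun y => (ψ y : Matrix (Fin 3) (Fin 3) ℂ) i j) y :=
  (h.smooth i j).contDiffAt (h.isOpen.mem_nhds hy)

section Fibre

variable {k l : ℤ} {j : Fin 3} {x : CP2} {ψ : E7 → SU3} {U : Set E7} {u : E3 → E7} {O : Set E3}
  {b : E3}

/-- Along the fibre the `j`-th column stays proportional to a fixed `w`, so its derivative is also
proportional to `w`. The `i`-th column is orthogonal to `w`. -/
theorem pullMC_off_eq_zero (h : IsParam k l (fibre k l j x) ψ U u O) (hb : b ∈ O) (t : E3)
    {i : Fin 3} (hi : i ≠ j) : pullMC ψ (u b) i j (fderiv ℝ u b t) = 0 := by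
  induction x using Projectivization.ind with
  | h w hw =>
    obtain ⟨r₀, hr₀⟩ := Function.ne_iff.1 hw
    simp only [Pi.zero_apply] at hr₀
    have hsm := contDiffAt_of_isChart h.isChart (h.mapsTo hb)
    have hu : DifferentiableAt ℝ u b :=
      (h.smooth.contDiffAt (h.isOpen.mem_nhds hb)).differentiableAt (by simp)
    have hd : ∀ r, HasFDerivAt (fun b => (ψ (u b) : Matrix (Fin 3) (Fin 3) ℂ) r j)
        ((fderiv ℝ (fun y => (ψ y : Matrix (Fin 3) (Fin 3) ℂ) r j) (u b)).comp (fderiv ℝ u b)) b :=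
      fun r => ((hsm r j).differentiableAt (by simp)).hasFDerivAt.comp b hu.hasFDerivAt
    -- Proportionality is written by cross-multiplication with the nonzero entry `w r₀`, which
    -- avoids differentiating the factor.
    have hprop : ∀ r, fderiv ℝ (fun y => (ψ y : Matrix (Fin 3) (Fin 3) ℂ) r j) (u b)
        (fderiv ℝ u b t) * w r₀ =
        fderiv ℝ (fun y => (ψ y : Matrix (Fin 3) (Fin 3) ℂ) r₀ j) (u b) (fderiv ℝ u b t) * w r := by
      intro r
      have heq : (fun b => (ψ (u b) : Matrix (Fin 3) (Fin 3) ℂ) r j * w r₀) =ᶠ[nhds b]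
          fun b => (ψ (u b) : Matrix (Fin 3) (Fin 3) ℂ) r₀ j * w r := by
        filter_upwards [h.isOpen.mem_nhds hb] with b' hb'
        obtain ⟨a, ha⟩ := (mem_fibre_iff k l j _ w hw).1 (h.mem b' hb')
        rw [ha, ha]
        ring
      have h1 := heq.fderiv_eq (𝕜 := ℝ)
      rw [((hd r).mul_const _).fderiv, ((hd r₀).mul_const _).fderiv] at h1
      have h2 := congrArg (fun L : E3 →L[ℝ] ℂ => L t) h1
      simp only [smul_apply, ContinuousLinearMap.comp_apply, smul_eq_mul] at h2
      linear_combination h2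
    obtain ⟨a, ha⟩ := (mem_fibre_iff k l j _ w hw).1 (h.mem b hb)
    have horth : ∑ r, conj ((ψ (u b) : Matrix (Fin 3) (Fin 3) ℂ) r i) * w r = 0 := by
      have h1 : (star (ψ (u b) : Matrix (Fin 3) (Fin 3) ℂ) * ψ (u b)) i j = 0 := by
        rw [Matrix.mem_unitaryGroup_iff'.1 (Matrix.mem_specialUnitaryGroup_iff.1 (ψ (u b)).2).1,
          Matrix.one_apply_ne hi]
      rw [star_mul_apply] at h1
      have ha0 : a ≠ 0 := by
        rintro rfl
        exact col_ne_zero (ψ (u b)) j (funext fun r => by rw [ha, zero_mul]; rfl)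
      refine (mul_eq_zero.1 (?_ : a * _ = 0)).resolve_left ha0
      rw [← h1, Finset.mul_sum]
      exact Finset.sum_congr rfl fun r _ => by rw [ha]; ring
    refine (mul_eq_zero.1 (?_ : _ * w r₀ = 0)).resolve_right hr₀
    rw [pullMC_apply, Finset.sum_mul]
    simp only [mul_assoc, hprop]
    simp only [mul_left_comm _ (fderiv ℝ (fun y => (ψ y : Matrix (Fin 3) (Fin 3) ℂ) r₀ j) (u b)
      (fderiv ℝ u b t)), ← Finset.mul_sum, horth, mul_zero]

theorem coframe_eq_zero_of_off {Ω : Fin 3 → Fin 3 → E7 →L[ℝ] ℂ} {v : E7}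
    (h₁ : ∀ i, i ≠ j → Ω i j v = 0) (h₂ : ∀ i, i ≠ j → Ω j i v = 0) {a : Fin 7}
    (ha : ∀ i, tangentIdx j i ≠ a) : coframe k l Ω a v = 0 := by
  fin_cases j
  · have := h₁ 1 (by decide); have := h₁ 2 (by decide)
    have := h₂ 1 (by decide); have := h₂ 2 (by decide)
    have := ha 0; have := ha 1; have := ha 2
    fin_cases a <;> simp_all [tangentIdx, coframe]
  · have := h₁ 0 (by decide); have := h₁ 2 (by decide)
    have := h₂ 0 (by decide); have := h₂ 2 (by decide)
    have := ha 0; have := ha 1; have := ha 2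
    fin_cases a <;> simp_all [tangentIdx, coframe]
  · have := h₁ 0 (by decide); have := h₁ 1 (by decide)
    have := h₂ 0 (by decide); have := h₂ 1 (by decide)
    have := ha 0; have := ha 1; have := ha 2
    fin_cases a <;> simp_all [tangentIdx, coframe]

theorem pullMC_off_eq_zero' (h : IsParam k l (fibre k l j x) ψ U u O) (hb : b ∈ O) (t : E3)
    {i : Fin 3} (hi : i ≠ j) : pullMC ψ (u b) j i (fderiv ℝ u b t) = 0 := by
  rw [pullMC_skew (contDiffAt_of_isChart h.isChart (h.mapsTo hb)), pullMC_off_eq_zero h hb t hi,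
    map_zero, neg_zero]

theorem coframe_normal_eq_zero (h : IsParam k l (fibre k l j x) ψ U u O) (hb : b ∈ O) (t : E3)
    {a : Fin 7} (ha : ∀ i, tangentIdx j i ≠ a) :
    coframe k l (pullMC ψ (u b)) a (fderiv ℝ u b t) = 0 :=
  coframe_eq_zero_of_off (fun _ hi => pullMC_off_eq_zero h hb t hi)
    (fun _ hi => pullMC_off_eq_zero' h hb t hi) ha

theorem tangentIdx_injective (j : Fin 3) : Function.Injective (tangentIdx j) := by
  revert j; decide

theorem sum_tangentIdx (j : Fin 3) {f : Fin 7 → ℝ} (hf : ∀ a, (∀ i, tangentIdx j i ≠ a) → f a = 0) :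
    ∑ a, f a = ∑ i, f (tangentIdx j i) := by
  rw [← Finset.sum_image (s := Finset.univ) (g := tangentIdx j) (f := f) (tangentIdx_injective j).injOn]
  refine (Finset.sum_subset (Finset.subset_univ _) fun a _ ha => hf a fun i hi => ha ?_).symm
  rw [← hi]
  exact Finset.mem_image_of_mem _ (Finset.mem_univ i)

/-- The matrix of components of three tangent vectors in the orthonormal coframe of the fibre. -/
def frameComponents (k l : ℤ) (A B C D : ℝ) (j : Fin 3) (ψ : E7 → SU3) (y : E7) (v : Fin 3 → E7) :
    Matrix (Fin 3) (Fin 3) ℝ :=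
  Matrix.of fun i i' => scales A B C D (tangentIdx j i') *
    coframe k l (pullMC ψ y) (tangentIdx j i') (v i)

theorem frameComponents_mul_transpose {A B C D : ℝ} (h : IsParam k l (fibre k l j x) ψ U u O)
    (hb : b ∈ O) {t : Fin 3 → E3}
    (ht : IsTangentFrame (metricChart k l A B C D ψ (u b)) u b t) :
    frameComponents k l A B C D j ψ (u b) (fun i => fderiv ℝ u b (t i)) *
      (frameComponents k l A B C D j ψ (u b) (fun i => fderiv ℝ u b (t i))).transpose = 1 := by
  ext i i'
  have h1 := ht i i'
  simp only [metricChart_eq] at h1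
  rw [sum_tangentIdx j] at h1
  · rw [Matrix.one_apply, ← h1, Matrix.mul_apply]
    refine Finset.sum_congr rfl fun s _ => ?_
    simp only [frameComponents, Matrix.transpose_apply, Matrix.of_apply]
    ring
  · intro a ha
    rw [coframe_normal_eq_zero h hb (t i) ha]
    ring

/-- Each other term of `φ_W` contains a form vanishing on the fibre, and the surviving term is minus
the determinant of the components in the scaled coframe. For an orthonormal frame this matrix is
orthogonal. -/
theorem isAssociative_fibre (k l : ℤ) (A B C D : ℝ) (j : Fin 3) (x : CP2) :
    IsAssociative k l A B C D (fibre k l j x) := by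
  intro ψ U u O h b hb t ht
  have hH := frameComponents_mul_transpose h hb ht
  have hdet := congrArg Matrix.det hH
  rw [Matrix.det_mul, Matrix.det_transpose, Matrix.det_one] at hdet
  have hz : ∀ (a : Fin 7), (∀ i, tangentIdx j i ≠ a) → ∀ i,
      coframe k l (pullMC ψ (u b)) a (fderiv ℝ u b (t i)) = 0 :=
    fun a ha i => coframe_normal_eq_zero h hb (t i) ha
  have hφ : phiChart k l A B C D ψ (u b) (fun i => fderiv ℝ u b (t i)) =
      -(frameComponents k l A B C D j ψ (u b) (fun i => fderiv ℝ u b (t i))).det := by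
    simp only [phiChart, phiW]
    fin_cases j
    · have h0 := hz 0 (by decide)
      have h2 := hz 2 (by decide)
      have h4 := hz 4 (by decide)
      have h6 := hz 6 (by decide)
      simp [wedge_apply, Matrix.det_fin_three, frameComponents, tangentIdx, scales, h0, h2, h4, h6]
      ring
    · have h0 := hz 0 (by decide)
      have h1 := hz 1 (by decide)
      have h4 := hz 4 (by decide)
      have h5 := hz 5 (by decide)
      simp [wedge_apply, Matrix.det_fin_three, frameComponents, tangentIdx, scales, h0, h1, h4, h5]
      ring
    · have h1 := hz 1 (by decide)
      have h2 := hz 2 (by decide)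
      have h5 := hz 5 (by decide)
      have h6 := hz 6 (by decide)
      simp [wedge_apply, Matrix.det_fin_three, frameComponents, tangentIdx, scales, h1, h2, h5, h6]
      ring
  rw [hφ, abs_neg]
  rcases mul_self_eq_one_iff.1 hdet with h1 | h1 <;> rw [h1] <;> simp

/-- The component matrix of the tangent frame is orthogonal, hence invertible, so orthogonality to
the frame forces the tangential components of `n` to vanish. -/
theorem coframe_tangent_eq_zero {A B C D : ℝ} (hs : ∀ a, scales A B C D a ≠ 0)
    (h : IsParam k l (fibre k l j x) ψ U u O) (hb : b ∈ O) {t : Fin 3 → E3}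
    (ht : IsTangentFrame (metricChart k l A B C D ψ (u b)) u b t) {n : E7}
    (hn : ∀ i, metricChart k l A B C D ψ (u b) n (fderiv ℝ u b (t i)) = 0) (s : Fin 3) :
    coframe k l (pullMC ψ (u b)) (tangentIdx j s) n = 0 := by
  set H := frameComponents k l A B C D j ψ (u b) (fun i => fderiv ℝ u b (t i)) with hHdef
  have hH : H * H.transpose = 1 := frameComponents_mul_transpose h hb ht
  have hH' : H.transpose * H = 1 := mul_eq_one_comm.1 hH
  set N : Fin 3 → ℝ := fun s => scales A B C D (tangentIdx j s) *
    coframe k l (pullMC ψ (u b)) (tangentIdx j s) n with hN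
  have h0 : H.mulVec N = 0 := by
    funext i
    have h1 := hn i
    simp only [metricChart_eq] at h1
    rw [sum_tangentIdx j] at h1
    · rw [Pi.zero_apply, ← h1, Matrix.mulVec, dotProduct]
      refine Finset.sum_congr rfl fun s _ => ?_
      simp only [hHdef, frameComponents, Matrix.of_apply, hN]
      ring
    · intro a ha
      rw [coframe_normal_eq_zero h hb (t i) ha]
      ring
  have hN0 : N = 0 := by
    rw [← Matrix.one_mulVec N, ← hH', ← Matrix.mulVec_mulVec, h0, Matrix.mulVec_zero]
  exact (mul_eq_zero.1 (congrFun hN0 s)).resolve_left (hs _)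

theorem coframe_tangentIdx (k l : ℤ) (j : Fin 3) (Ω : Fin 3 → Fin 3 → E7 →L[ℝ] ℂ) (v : E7) :
    coframe k l Ω (tangentIdx j 0) v = √2 * (Ω (j + 1) (j + 2) v).re ∧
      coframe k l Ω (tangentIdx j 1) v = √2 * (Ω (j + 1) (j + 2) v).im ∧
      coframe k l Ω (tangentIdx j 2) v =
        √2 / (6 * sNorm k l) * ∑ i, (coweight k l i : ℝ) * (Ω i i v).im := by
  fin_cases j <;> simp [coframe, tangentIdx]

theorem scales_tangentIdx (A B C D : ℝ) (j : Fin 3) :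
    scales A B C D (tangentIdx j 1) = scales A B C D (tangentIdx j 0) := by
  fin_cases j <;> rfl

/-- For a tangent vector `p` and a normal vector `n`, `∑ eᵃ(p) deᵃ(p, n) = 0`, by the structure
equations. -/
theorem sum_coframe_mul_d_eq_zero {k l : ℤ} (j : Fin 3) (A B C D : ℝ)
    {Ω : Fin 3 → Fin 3 → E7 →L[ℝ] ℂ} {Dp Dn : Fin 3 → Fin 3 → E7 →L[ℝ] ℂ} {p n : E7}
    (hskew : ∀ i i' v, Ω i i' v = -conj (Ω i' i v))
    (hMC : ∀ i i', Dp i i' n - Dn i i' p = ∑ s, (Ω i s n * Ω s i' p - Ω i s p * Ω s i' n))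
    (h₁ : ∀ i, i ≠ j → Ω i j p = 0) (h₂ : ∀ i, i ≠ j → Ω j i p = 0)
    (hn : ∀ s, coframe k l Ω (tangentIdx j s) n = 0) :
    ∑ a, scales A B C D a ^ 2 * (coframe k l Ω a p * (coframe k l Dp a n - coframe k l Dn a p)) =
      0 := by
  obtain ⟨n0, n1, -⟩ := coframe_tangentIdx k l j Ω n
  have h2 : √2 ≠ 0 := by positivity
  rw [hn] at n0 n1
  have hαβ : Ω (j + 1) (j + 2) n = 0 := Complex.ext
    ((mul_eq_zero.1 n0.symm).resolve_left h2) ((mul_eq_zero.1 n1.symm).resolve_left h2)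
  have hβα : Ω (j + 2) (j + 1) n = 0 := by rw [hskew, hαβ, map_zero, neg_zero]
  have hα : j + 1 ≠ j := by simp
  have hβ : j + 2 ≠ j := by simp
  have hjα := h₂ _ hα
  have hjβ := h₂ _ hβ
  have hαj := h₁ _ hα
  have hβj := h₁ _ hβ
  have him : ∀ i v, (Ω i i v).re = 0 := fun i v => by
    have := congrArg Complex.re (hskew i i v)
    simp at this
    linarith
  -- The factor is imaginary, since `Ω` has imaginary diagonal entries. It accounts for an
  -- infinitesimal rotation of the plane of the first two tangential forms, and a rotation is
  -- orthogonal to the vector it moves.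
  have dαβ : Dp (j + 1) (j + 2) n - Dn (j + 1) (j + 2) p =
      (Ω (j + 1) (j + 1) n - Ω (j + 2) (j + 2) n) * Ω (j + 1) (j + 2) p := by
    rw [hMC, sum_fin_three_cyclic _ j, hjβ, hαj, hαβ]
    ring
  have dii : ∀ i, Dp i i n - Dn i i p = 0 := by
    intro i
    rw [hMC, sum_fin_three_cyclic _ j]
    rcases eq_cyclic i j with rfl | rfl | rfl
    · rw [hjα, hjβ, hαj, hβj]
      ring
    · rw [hjα, hαj, hαβ, hβα]
      ring
    · rw [hjβ, hβj, hαβ, hβα]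
      ring
  rw [sum_tangentIdx j, Fin.sum_univ_three]
  · obtain ⟨a0, a1, a2⟩ := coframe_tangentIdx k l j Ω p
    obtain ⟨b0, b1, b2⟩ := coframe_tangentIdx k l j Dp n
    obtain ⟨c0, c1, c2⟩ := coframe_tangentIdx k l j Dn p
    have e2 : coframe k l Dp (tangentIdx j 2) n - coframe k l Dn (tangentIdx j 2) p = 0 := by
      rw [b2, c2, ← mul_sub, ← Finset.sum_sub_distrib]
      refine mul_eq_zero_of_right _ (Finset.sum_eq_zero fun i _ => ?_)
      rw [← mul_sub, ← Complex.sub_im, dii, Complex.zero_im, mul_zero]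
    have e0 : coframe k l Dp (tangentIdx j 0) n - coframe k l Dn (tangentIdx j 0) p =
        √2 * ((Ω (j + 1) (j + 1) n - Ω (j + 2) (j + 2) n) * Ω (j + 1) (j + 2) p).re := by
      rw [b0, c0, ← mul_sub, ← Complex.sub_re, dαβ]
    have e1 : coframe k l Dp (tangentIdx j 1) n - coframe k l Dn (tangentIdx j 1) p =
        √2 * ((Ω (j + 1) (j + 1) n - Ω (j + 2) (j + 2) n) * Ω (j + 1) (j + 2) p).im := by
      rw [b1, c1, ← mul_sub, ← Complex.sub_im, dαβ]
    rw [e0, e1, e2, a0, a1, scales_tangentIdx]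
    simp only [Complex.mul_re, Complex.mul_im, Complex.sub_re, Complex.sub_im, him]
    ring
  · intro a ha
    rw [coframe_eq_zero_of_off h₁ h₂ ha]
    ring

/-- Every term of the trace vanishes separately: `II(t, t)` paired with `n` splits into a derivative
part, zero by `hnormal`, and the exterior derivative part of `sum_coframe_mul_d_eq_zero`. -/
theorem isMinimal_fibre {A B C D : ℝ} (hs : ∀ a, scales A B C D a ≠ 0) (j : Fin 3) (x : CP2) :
    IsMinimal k l A B C D (fibre k l j x) := by
  intro ψ U u O h b hb t ht n hn
  refine Finset.sum_eq_zero fun i _ => ?_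
  have hsm := contDiffAt_of_isChart h.isChart (h.mapsTo hb)
  have hu := h.smooth.contDiffAt (h.isOpen.mem_nhds hb)
  have hdiff : ∀ a, DifferentiableAt ℝ (fun y => coframe k l (pullMC ψ y) a) (u b) := fun a =>
    (hasFDerivAt_coframe k l hsm a).differentiableAt
  have hT := coframe_tangent_eq_zero hs h hb ht hn
  rw [metricChart_eq, christoffel_coframe hdiff, ← Finset.sum_add_distrib]
  set p := fderiv ℝ u b (t i) with hp
  -- For a tangential index the factor `eᵃ(n)` is zero; for a normal index `eᵃ(∂ₜu)` is identically
  -- zero along `u`, and so is its derivative.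
  have hnormal : ∀ a, (fderiv ℝ (fun y => coframe k l (pullMC ψ y) a) (u b) p p +
      coframe k l (pullMC ψ (u b)) a (fderiv ℝ (fderiv ℝ u) b (t i) (t i))) *
        coframe k l (pullMC ψ (u b)) a n = 0 := by
    intro a
    by_cases ha : ∃ s, tangentIdx j s = a
    · obtain ⟨s, rfl⟩ := ha
      rw [hT s, mul_zero]
    · push Not at ha
      rw [hp, ← fderiv_coframe_comp (hdiff a) hu]
      have heq : (fun b' => coframe k l (pullMC ψ (u b')) a (fderiv ℝ u b' (t i))) =ᶠ[nhds b]
          fun _ => 0 := by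
        filter_upwards [h.isOpen.mem_nhds hb] with b' hb'
        exact coframe_normal_eq_zero h hb' (t i) ha
      rw [heq.fderiv_eq]
      simp
  have hd := sum_coframe_mul_d_eq_zero (k := k) (l := l) j A B C D (pullMC_skew hsm)
    (fun i i' => structure_equation hsm i i' p n)
    (fun i' hi => pullMC_off_eq_zero h hb (t i) hi)
    (fun i' hi => pullMC_off_eq_zero' h hb (t i) hi) hT
  rw [← hd]
  refine Finset.sum_congr rfl fun a _ => ?_
  rw [← fderiv_coframe k l hsm, ← fderiv_coframe k l hsm]
  linear_combination scales A B C D a ^ 2 * hnormal a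

end Fibre

/-! ### Maps from `S³` lift through coverings -/

section Lifting

variable {E X : Type*} [TopologicalSpace E] [TopologicalSpace X] {p : E → X}

theorem stereographic_source' (v : S3) :
    (stereographic (norm_eq_of_mem_sphere v)).source = {v}ᶜ := by
  rw [stereographic_source]

theorem ne_neg_sphere (v : S3) : v ≠ -v := by
  intro h
  refine ne_zero_of_mem_unit_sphere v ?_
  ext i
  have h1 : v.1 = -v.1 := congrArg Subtype.val h
  have h2 : v.1 i = -v.1 i := congrArg (fun w : EuclideanSpace ℝ (Fin (3 + 1)) => w i) h1
  change v.1 i = 0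
  linarith

theorem exists_lift_compl_singleton (hp : IsCoveringMap p) {f : S3 → X} (hf : Continuous f)
    {v x₀ : S3} (hx₀ : x₀ ≠ v) {e₀ : E} (he₀ : p e₀ = f x₀) :
    ∃ g : S3 → E, ContinuousOn g {v}ᶜ ∧ (∀ x, x ≠ v → p (g x) = f x) ∧ g x₀ = e₀ := by
  set φ := stereographic (norm_eq_of_mem_sphere v) with hφ
  have hsrc : φ.source = {v}ᶜ := stereographic_source' v
  have htgt : φ.target = Set.univ := stereographic_target _
  have hsymm : Continuous φ.symm := by
    have h := φ.continuousOn_symm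
    rwa [htgt, continuousOn_univ] at h
  have hleft : ∀ x, x ≠ v → φ.symm (φ x) = x := fun x hx => φ.left_inv (by rw [hsrc]; exact hx)
  obtain ⟨g, ⟨hg₀, hg⟩, -⟩ := hp.existsUnique_continuousMap_lifts
    (⟨f ∘ φ.symm, hf.comp hsymm⟩ : C((ℝ ∙ (v : EuclideanSpace ℝ (Fin (3 + 1))))ᗮ, X)) (φ x₀) e₀
    (by simp [he₀, hleft x₀ hx₀])
  refine ⟨g ∘ φ, ?_, fun x hx => ?_, hg₀⟩
  · rw [← hsrc]
    exact g.continuous.comp_continuousOn φ.continuousOn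
  · have h := congrFun hg (φ x)
    simpa [hleft x hx] using h

theorem isPreconnected_compl_poles (v : S3) : IsPreconnected ({v}ᶜ ∩ {-v}ᶜ : Set S3) := by
  set φ := stereographic (norm_eq_of_mem_sphere v) with hφ
  have hsrc : φ.source = {v}ᶜ := stereographic_source' v
  have htgt : φ.target = Set.univ := stereographic_target _
  have hneg : φ (-v) = 0 := stereographic_apply_neg v
  have hne : -v ≠ v := (ne_neg_sphere v).symm
  have hset : ({v}ᶜ ∩ {-v}ᶜ : Set S3) = φ.symm '' {0}ᶜ := by
    ext x
    constructor
    · rintro ⟨h1, h2⟩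
      have hx : x ∈ φ.source := by rw [hsrc]; exact h1
      refine ⟨φ x, fun h0 => h2 ?_, φ.left_inv hx⟩
      exact φ.injOn hx (by rw [hsrc]; exact hne) (h0.trans hneg.symm)
    · rintro ⟨w, hw, rfl⟩
      have hwt : w ∈ φ.target := by rw [htgt]; trivial
      refine ⟨by rw [← hsrc]; exact φ.map_target hwt, fun h => hw ?_⟩
      have h1 := φ.right_inv hwt
      rw [Set.mem_singleton_iff.1 h, hneg] at h1
      exact h1.symm
  rw [hset]
  refine IsPreconnected.image ?_ _ ?_
  · refine (isConnected_compl_singleton_of_one_lt_rank ?_ 0).isPreconnected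
    refine Module.lt_rank_of_lt_finrank ?_
    rw [Submodule.finrank_orthogonal_span_singleton (n := 3) (ne_zero_of_mem_unit_sphere v)]
    norm_num
  · exact φ.continuousOn_symm.mono (by rw [htgt]; exact Set.subset_univ _)

/-- Simple connectedness of `S³` in the form needed. The complements of `v` and `-v` are copies of a
vector space by stereographic projection, so `f` lifts over each; the overlap is a 3-space minus a
point, which is connected, so lifts agreeing at `x₀` agree there and glue. -/
theorem exists_lift_sphere (hp : IsCoveringMap p) {f : S3 → X} (hf : Continuous f) (x₀ : S3)
    {e₀ : E} (he₀ : p e₀ = f x₀) :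
    ∃ g : S3 → E, Continuous g ∧ p ∘ g = f ∧ g x₀ = e₀ := by
  -- Otherwise `x₀` would be plus or minus every basis vector at once.
  obtain ⟨v, hv, hv'⟩ : ∃ v : S3, x₀ ≠ v ∧ x₀ ≠ -v := by
    by_contra! h
    let w : Fin (3 + 1) → S3 := fun i => ⟨EuclideanSpace.single i 1, by simp⟩
    have key : ∀ i, x₀.1 i ≠ 0 := by
      intro i hi
      by_cases h1 : x₀ = w i
      · rw [h1] at hi
        simp [w] at hi
      · have h2 := h (w i) h1
        rw [h2] at hi
        simp [w] at hi
    have h0 : x₀.1 1 = 0 := by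
      by_cases h1 : x₀ = w 0
      · rw [h1]
        simp [w]
      · rw [h (w 0) h1]
        simp [w]
    exact key 1 h0
  obtain ⟨g₁, hg₁, hl₁, h₁⟩ := exists_lift_compl_singleton hp hf hv he₀
  obtain ⟨g₂, hg₂, hl₂, h₂⟩ := exists_lift_compl_singleton hp hf hv' he₀
  have heq : Set.EqOn g₁ g₂ ({v}ᶜ ∩ {-v}ᶜ) := by
    refine hp.eqOn_of_comp_eqOn (isPreconnected_compl_poles v) (hg₁.mono Set.inter_subset_left)
      (hg₂.mono Set.inter_subset_right) (fun x hx => ?_) (a := x₀) ⟨hv, hv'⟩ (h₁.trans h₂.symm)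
    exact (hl₁ x hx.1).trans (hl₂ x hx.2).symm
  have hvne := ne_neg_sphere v
  classical
  refine ⟨fun x => if x = v then g₂ x else g₁ x, ?_, ?_, ?_⟩
  · rw [continuous_iff_continuousAt]
    intro x
    by_cases hx : x = v
    · have hx' : x ∈ ({-v}ᶜ : Set S3) := by rw [hx]; exact hvne
      refine (hg₂.continuousAt (isOpen_compl_singleton.mem_nhds hx')).congr ?_
      filter_upwards [isOpen_compl_singleton.mem_nhds hx'] with y hy
      by_cases hyv : y = v
      · rw [if_pos hyv]
      · rw [if_neg hyv, heq ⟨hyv, hy⟩]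
    · refine (hg₁.continuousAt (isOpen_compl_singleton.mem_nhds hx)).congr ?_
      filter_upwards [isOpen_compl_singleton.mem_nhds hx] with y hy
      exact (if_neg hy).symm
  · funext x
    by_cases hx : x = v
    · simp only [Function.comp_apply, if_pos hx]
      exact hl₂ x (by rw [hx]; exact hvne)
    · simp only [Function.comp_apply, if_neg hx]
      exact hl₁ x hx
  · simp only [if_neg hv]
    exact h₁

end Lifting

instance preconnectedSpace_S3 : PreconnectedSpace S3 := by
  refine isPreconnected_iff_preconnectedSpace.1 ?_
  refine isPreconnected_sphere (Module.lt_rank_of_lt_finrank ?_) _ _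
  simp

/-- `Φ` and its inverse lift to maps of `S³` which are mutually inverse by uniqueness of lifts. They
match the covering fibre over `q₁ x₀` with the one over its image, and each covering fibre is a
torsor of its group. This replaces a comparison of fundamental groups. -/
theorem card_eq_of_homeomorph {Y₁ Y₂ G₁ G₂ : Type*} [TopologicalSpace Y₁] [TopologicalSpace Y₂]
    [Group G₁] [Group G₂] [MulAction G₁ S3] [MulAction G₂ S3] {q₁ : S3 → Y₁} {q₂ : S3 → Y₂}
    (h₁ : IsQuotientCoveringMap q₁ G₁) (h₂ : IsQuotientCoveringMap q₂ G₂) (Φ : Y₁ ≃ₜ Y₂)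
    (x₀ : S3) : Nat.card G₁ = Nat.card G₂ := by
  have c₁ := h₁.isCoveringMap
  have c₂ := h₂.isCoveringMap
  obtain ⟨y₀, hy₀⟩ := h₂.surjective (Φ (q₁ x₀))
  obtain ⟨F, hF, hqF, hF₀⟩ := exists_lift_sphere c₂ (Φ.continuous.comp c₁.continuous) x₀ hy₀
  obtain ⟨G, hG, hqG, hG₀⟩ := exists_lift_sphere c₁ (Φ.symm.continuous.comp c₂.continuous) y₀
    (e₀ := x₀) (by simp [hy₀])
  have hqF' : ∀ x, q₂ (F x) = Φ (q₁ x) := congrFun hqF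
  have hqG' : ∀ x, q₁ (G x) = Φ.symm (q₂ x) := congrFun hqG
  have hGF : G ∘ F = id := c₁.eq_of_comp_eq (hG.comp hF) continuous_id
    (by funext x; simp [hqG', hqF']) x₀ (by simp [hF₀, hG₀])
  have hFG : F ∘ G = id := c₂.eq_of_comp_eq (hF.comp hG) continuous_id
    (by funext x; simp [hqG', hqF']) y₀ (by simp [hF₀, hG₀])
  have e : q₁ ⁻¹' {q₁ x₀} ≃ q₂ ⁻¹' {q₂ y₀} :=
    { toFun := fun x => ⟨F x.1, by
        have : q₁ x.1 = q₁ x₀ := x.2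
        simp [hqF', this, hy₀]⟩
      invFun := fun y => ⟨G y.1, by
        have : q₂ y.1 = q₂ y₀ := y.2
        simp [hqG', this, hy₀]⟩
      left_inv := fun x => Subtype.ext (congrFun hGF x.1)
      right_inv := fun y => Subtype.ext (congrFun hFG y.1) }
  calc Nat.card G₁ = Nat.card (q₁ ⁻¹' {q₁ x₀}) :=
        (Nat.card_congr (h₁.fiberEquivGroup ⟨x₀, rfl⟩)).symm
    _ = Nat.card (q₂ ⁻¹' {q₂ y₀}) := Nat.card_congr e
    _ = Nat.card G₂ := Nat.card_congr (h₂.fiberEquivGroup ⟨y₀, rfl⟩)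

/-! ### The three families are different -/

/-- The unit quaternions `(1, 0)` and `(0, 1)` of `ℂ²` give two points of a fibre of `π_i` whose
`j`-th columns are orthogonal. In a fibre of `π_j` these columns would be nonzero multiples of the
same vector. -/
theorem fibre_ne_fibre {k l : ℤ} {i j : Fin 3} (hw : weight k l i ≠ 0) (hij : i ≠ j) (x y : CP2) :
    fibre k l i x ≠ fibre k l j y := by
  intro h
  obtain ⟨g, rfl⟩ := exists_linePoint_eq i x
  rw [← range_tube hw g 0] at h
  let e : Fin (3 + 1) → S3 := fun s => ⟨EuclideanSpace.single s 1, by simp⟩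
  induction y using Projectivization.ind with
  | h w hw' =>
    have hmem : ∀ s, (tube g i (0, e s) : W k l) ∈ fibre k l j (Projectivization.mk ℂ w hw') :=
      fun s => by rw [← h]; exact ⟨e s, rfl⟩
    obtain ⟨a₁, ha₁⟩ := (mem_fibre_iff k l j _ w hw').1 (hmem 0)
    obtain ⟨a₂, ha₂⟩ := (mem_fibre_iff k l j _ w hw').1 (hmem 2)
    have hcol : ∀ (s : Fin (3 + 1)) (a : ℂ),
        (∀ r, (tube g i (0, e s) : Matrix (Fin 3) (Fin 3) ℂ) r j = a * w r) → a ≠ 0 := by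
      rintro s a ha rfl
      exact col_ne_zero (tube g i (0, e s)) j (funext fun r => by rw [ha, zero_mul]; rfl)
    have h₁ := hcol 0 a₁ ha₁
    have h₂ := hcol 2 a₂ ha₂
    have hu := Matrix.mem_unitaryGroup_iff'.1
      (Matrix.mem_specialUnitaryGroup_iff.1 (tube g i (0, e 0)).2).1
    have hjj := congrFun (congrFun hu j) j
    rw [star_mul_apply, Matrix.one_apply_eq] at hjj
    have hprod : (star (tube g i (0, e 0) : Matrix (Fin 3) (Fin 3) ℂ) *
        (tube g i (0, e 2) : Matrix (Fin 3) (Fin 3) ℂ)) j j = a₂ / a₁ := by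
      rw [star_mul_apply, ← mul_one (a₂ / a₁), ← hjj, Finset.mul_sum]
      refine Finset.sum_congr rfl fun r _ => ?_
      rw [ha₂, ha₁]
      field_simp
    have hzero : (star (tube g i (0, e 0) : Matrix (Fin 3) (Fin 3) ℂ) *
        (tube g i (0, e 2) : Matrix (Fin 3) (Fin 3) ℂ)) j j = 0 := by
      have hT := Matrix.mem_unitaryGroup_iff'.1
        (Matrix.mem_specialUnitaryGroup_iff.1 (tubeBase g i 0).2).1
      change (star (tubeMatrix g i (0, (e 0).1)) * tubeMatrix g i (0, (e 2).1)) j j = 0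
      rw [tubeMatrix_eq_base, tubeMatrix_eq_base, star_mul, mul_assoc,
        ← mul_assoc (star (tubeBase g i _ : Matrix (Fin 3) (Fin 3) ℂ)), hT, one_mul,
        Matrix.star_eq_conjTranspose, Matrix.conjTranspose_submatrix, Matrix.submatrix_mul_equiv,
        Matrix.submatrix_apply, ← Matrix.star_eq_conjTranspose, star_mul_apply]
      have hne : relabel i j ≠ 2 := by
        rw [← relabel_self i]
        exact fun h => hij ((relabel i).injective h).symm
      have c₁ : cplx₁ (e 0).1 = 1 := by apply Complex.ext <;> simp [cplx₁, e]
      have c₂ : cplx₂ (e 0).1 = 0 := by apply Complex.ext <;> simp [cplx₂, e]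
      have d₁ : cplx₁ (e 2).1 = 0 := by apply Complex.ext <;> simp [cplx₁, e]
      have d₂ : cplx₂ (e 2).1 = 1 := by apply Complex.ext <;> simp [cplx₂, e]
      generalize relabel i j = s at hne
      simp only [blockMatrix_eq, Fin.sum_univ_three]
      fin_cases s
      · simp [c₁, c₂, d₁, d₂]
      · simp [c₁, c₂, d₁, d₂]
      · exact absurd rfl hne
    rw [hprod] at hzero
    exact div_ne_zero h₂ h₁ hzero

/-! ### The fibres as quotients of `S³` -/

/-- Multiplication by a complex number on `ℝ⁴ = ℂ²`. -/
def scalarMul (ζ : ℂ) (x : E4) : E4 :=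
  !₂[(ζ * cplx₁ x).re, (ζ * cplx₁ x).im, (ζ * cplx₂ x).re, (ζ * cplx₂ x).im]

@[simp] theorem cplx₁_scalarMul (ζ : ℂ) (x : E4) : cplx₁ (scalarMul ζ x) = ζ * cplx₁ x := by
  apply Complex.ext <;> simp [cplx₁, scalarMul]

@[simp] theorem cplx₂_scalarMul (ζ : ℂ) (x : E4) : cplx₂ (scalarMul ζ x) = ζ * cplx₂ x := by
  apply Complex.ext <;> simp [cplx₂, scalarMul]

theorem norm_scalarMul (ζ : ℂ) (x : E4) : ‖scalarMul ζ x‖ = ‖ζ‖ * ‖x‖ := by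
  have h := cplx_norm (scalarMul ζ x)
  have h' := cplx_norm x
  rw [cplx₁_scalarMul, cplx₂_scalarMul] at h
  have hc : ((‖scalarMul ζ x‖ ^ 2 : ℝ) : ℂ) = (((‖ζ‖ * ‖x‖) ^ 2 : ℝ) : ℂ) := by
    rw [← h, mul_pow, Complex.ofReal_mul, ← h', ← Complex.normSq_eq_norm_sq, ← Complex.mul_conj]
    simp only [map_mul]
    ring
  have hr : ‖scalarMul ζ x‖ ^ 2 = (‖ζ‖ * ‖x‖) ^ 2 := by exact_mod_cast hc
  exact (sq_eq_sq₀ (norm_nonneg _) (by positivity)).1 hr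

theorem continuous_scalarMul (ζ : ℂ) : Continuous (scalarMul ζ) := by
  have h₁ := contDiff_cplx₁.continuous
  have h₂ := contDiff_cplx₂.continuous
  refine (PiLp.continuous_toLp 2 _).comp (continuous_pi fun i => ?_)
  fin_cases i
  · exact Complex.continuous_re.comp (continuous_const.mul h₁)
  · exact Complex.continuous_im.comp (continuous_const.mul h₁)
  · exact Complex.continuous_re.comp (continuous_const.mul h₂)
  · exact Complex.continuous_im.comp (continuous_const.mul h₂)

theorem norm_rootsOfUnity {p : ℕ} [NeZero p] (ζ : rootsOfUnity p ℂ) : ‖((ζ : ℂˣ) : ℂ)‖ = 1 :=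
  Complex.norm_eq_one_of_pow_eq_one ((mem_rootsOfUnity' p _).1 ζ.2) (NeZero.ne p)

/-- The group of `p`-th roots of unity acts on `S³ ⊂ ℂ²`. -/
instance rootsOfUnityAction (p : ℕ) [NeZero p] : MulAction (rootsOfUnity p ℂ) S3 where
  smul ζ x := ⟨scalarMul ((ζ : ℂˣ) : ℂ) x.1, by
    rw [mem_sphere_zero_iff_norm, norm_scalarMul, norm_rootsOfUnity, one_mul]
    exact norm_eq_of_mem_sphere x⟩
  one_smul x := Subtype.ext (cplx_ext
    (by change cplx₁ (scalarMul _ _) = _; simp) (by change cplx₂ (scalarMul _ _) = _; simp))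
  mul_smul ζ ξ x := Subtype.ext (cplx_ext
    (by change cplx₁ (scalarMul _ _) = cplx₁ (scalarMul _ (scalarMul _ _)); simp [mul_assoc])
    (by change cplx₂ (scalarMul _ _) = cplx₂ (scalarMul _ (scalarMul _ _)); simp [mul_assoc]))

instance continuousConstSMul_sphere (p : ℕ) [NeZero p] :
    ContinuousConstSMul (rootsOfUnity p ℂ) S3 where
  continuous_const_smul ζ :=
    ((continuous_scalarMul ((ζ : ℂˣ) : ℂ)).comp continuous_subtype_val).subtype_mk _

instance isCancelSMul_sphere (p : ℕ) [NeZero p] : IsCancelSMul (rootsOfUnity p ℂ) S3 := by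
  rw [isCancelSMul_iff_eq_one_of_smul_eq]
  intro ζ x h
  have h1 : scalarMul ((ζ : ℂˣ) : ℂ) x.1 = x.1 := congrArg Subtype.val h
  have h2 := norm_sub_of_orbit (norm_eq_of_mem_sphere x) (cplx₁_scalarMul ((ζ : ℂˣ) : ℂ) x.1)
    (cplx₂_scalarMul ((ζ : ℂˣ) : ℂ) x.1)
  rw [h1, sub_self, norm_zero, norm_eq_zero, sub_eq_zero] at h2
  exact Subtype.ext (Units.ext h2)

theorem sameOrbit_iff_mem_orbit (p : ℕ) [NeZero p] (x y : S3) :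
    SameOrbit p y x ↔ x ∈ MulAction.orbit (rootsOfUnity p ℂ) y := by
  rw [sameOrbit_iff]
  constructor
  · rintro ⟨ζ, hζ, h₁, h₂⟩
    have hζ0 : ζ ≠ 0 := by
      rintro rfl
      rw [zero_pow (NeZero.ne p)] at hζ
      exact zero_ne_one hζ
    refine ⟨⟨Units.mk0 ζ hζ0, (mem_rootsOfUnity' p _).2 hζ⟩, Subtype.ext (cplx_ext ?_ ?_)⟩
    · change cplx₁ (scalarMul ζ y.1) = _
      rw [cplx₁_scalarMul, h₁]
    · change cplx₂ (scalarMul ζ y.1) = _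
      rw [cplx₂_scalarMul, h₂]
  · rintro ⟨ζ, rfl⟩
    exact ⟨((ζ : ℂˣ) : ℂ), (mem_rootsOfUnity' p _).1 ζ.2, cplx₁_scalarMul _ _,
      cplx₂_scalarMul _ _⟩

instance isTopologicalGroup_SU3 : IsTopologicalGroup SU3 where
  continuous_inv := by
    refine Continuous.subtype_mk ?_ _
    exact (continuous_subtype_val.star : Continuous fun g : SU3 =>
      star (g : Matrix (Fin 3) (Fin 3) ℂ))

/-- The weights are integers, so the circle is the image of a continuous periodic map and is
compact. Closedness makes the quotient `W k l` Hausdorff. -/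
theorem isClosed_circle (k l : ℤ) : IsClosed (circle k l : Set SU3) := by
  let δ : ℝ → SU3 := fun θ => ⟨Matrix.diagonal (phase k l θ), diagonal_phase_mem k l θ⟩
  have hδ : Continuous δ := by
    refine Continuous.subtype_mk (Continuous.matrix_diagonal (continuous_pi fun i => ?_)) _
    unfold phase
    fun_prop
  have hper : Function.Periodic δ (2 * Real.pi) := by
    intro θ
    apply Subtype.ext
    change Matrix.diagonal _ = Matrix.diagonal _
    congr 1
    funext i
    rw [phase, phase, Complex.exp_eq_exp_iff_exists_int]
    refine ⟨weight k l i, ?_⟩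
    push_cast
    ring
  have hrange : (circle k l : Set SU3) = Set.range δ := by
    ext h
    constructor
    · rintro ⟨θ, hθ⟩
      exact ⟨θ, Subtype.ext hθ.symm⟩
    · rintro ⟨θ, rfl⟩
      exact ⟨θ, rfl⟩
  rw [hrange]
  exact (hper.compact_of_continuous (by positivity) hδ).isClosed

instance t2Space_W (k l : ℤ) : T2Space (W k l) :=
  have := isClosed_circle k l
  QuotientGroup.instT2Space

theorem continuous_tube (g : SU3) (j : Fin 3) : Continuous (tube g j) :=
  Continuous.subtype_mk (continuous_matrix fun i i' => (contMDiff_tube g j i i').continuous) _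

/-- A continuous surjection from the compact `S³` to a Hausdorff space is a quotient map. Its fibres
are the orbits of a finite group acting freely, by `tube_eq_iff`, so it is a covering. -/
theorem exists_quotientCoveringMap {k l : ℤ} (hkl : IsCoprime k l) {j : Fin 3}
    (hw : weight k l j ≠ 0) [NeZero (weight k l j).natAbs] (x : CP2) :
    ∃ q : S3 → fibre k l j x, IsQuotientCoveringMap q (rootsOfUnity (weight k l j).natAbs ℂ) := by
  obtain ⟨g, rfl⟩ := exists_linePoint_eq j x
  have hr := range_tube hw g 0
  let q : S3 → fibre k l j (linePoint g j 0) := fun x =>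
    ⟨(tube g j (0, x) : W k l), by rw [← hr]; exact ⟨x, rfl⟩⟩
  have hq : Continuous q := by
    refine Continuous.subtype_mk ?_ _
    exact continuous_quotient_mk'.comp ((continuous_tube g j).comp (by fun_prop))
  have hsurj : Function.Surjective q := by
    rintro ⟨y, hy⟩
    rw [← hr] at hy
    obtain ⟨x, hx⟩ := hy
    exact ⟨x, Subtype.ext hx⟩
  have hquot : Topology.IsQuotientMap q := hq.isClosedMap.isQuotientMap hq hsurj
  refine ⟨q, hquot.isQuotientCoveringMap_of_properlyDiscontinuousSMul fun {x y} => ?_⟩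
  rw [← sameOrbit_iff_mem_orbit, Subtype.ext_iff, eq_comm]
  exact (tube_eq_iff hkl hw g 0 0 y x).trans (and_iff_right rfl)

theorem isEmpty_homeomorph_fibre {k l : ℤ} (hkl : IsCoprime k l) (hw : ∀ j, weight k l j ≠ 0)
    {i j : Fin 3} (hij : |weight k l i| ≠ |weight k l j|) (x y : CP2) :
    IsEmpty (fibre k l i x ≃ₜ fibre k l j y) := by
  refine ⟨fun Φ => hij ?_⟩
  have : NeZero (weight k l i).natAbs := ⟨Int.natAbs_ne_zero.2 (hw i)⟩
  have : NeZero (weight k l j).natAbs := ⟨Int.natAbs_ne_zero.2 (hw j)⟩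
  obtain ⟨q₁, h₁⟩ := exists_quotientCoveringMap hkl (hw i) x
  obtain ⟨q₂, h₂⟩ := exists_quotientCoveringMap hkl (hw j) y
  have h := card_eq_of_homeomorph h₁ h₂ Φ ⟨EuclideanSpace.single 0 1, by simp⟩
  rw [Complex.card_rootsOfUnity, Complex.card_rootsOfUnity] at h
  rw [Int.abs_eq_natAbs, Int.abs_eq_natAbs, h]

end AloffWallach

end

/-! ### The three families of minimal associative space forms -/

theorem mainTheorem10 (k l : ℤ) (hk : k ≠ 0) (hl : l ≠ 0) (hkl : IsCoprime k l)
    (hgen₁ : ({k, l, -k - l} : Multiset ℤ) ≠ {1, 1, -2})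
    (hgen₂ : ({k, l, -k - l} : Multiset ℤ) ≠ {1, -1, 0})
    (A B C D : ℝ) (hA : A ≠ 0) (hB : B ≠ 0) (hC : C ≠ 0) (hD : D ≠ 0)
    (hnp : AloffWallach.IsNearlyParallel k l A B C D) :
    -- the fibres of the canonical fibration are embedded minimal associative 3-folds
    (∀ x : AloffWallach.CP2,
      AloffWallach.IsEmbeddedThreefold k l (AloffWallach.fibre k l 2 x) ∧
      AloffWallach.IsMinimal k l A B C D (AloffWallach.fibre k l 2 x) ∧
      AloffWallach.IsAssociative k l A B C D (AloffWallach.fibre k l 2 x)) ∧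
    -- there are three 4-dimensional families of minimal associative spherical space forms
    (∀ j : Fin 3,
      AloffWallach.IsSpaceFormFamily k l (AloffWallach.weight k l j).natAbs
        (AloffWallach.fibre k l j) ∧
      ∀ x : AloffWallach.CP2,
        AloffWallach.IsEmbeddedThreefold k l (AloffWallach.fibre k l j x) ∧
        AloffWallach.IsMinimal k l A B C D (AloffWallach.fibre k l j x) ∧
        AloffWallach.IsAssociative k l A B C D (AloffWallach.fibre k l j x)) ∧
    -- the three families are different: they have no common members
    (∀ i j : Fin 3, i ≠ j → ∀ x y : AloffWallach.CP2,
      AloffWallach.fibre k l i x ≠ AloffWallach.fibre k l j y) ∧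
    -- for `|k|, |l|, |m|` pairwise distinct, their members are not even homeomorphic
    (Function.Injective (fun j : Fin 3 => |AloffWallach.weight k l j|) →
      ∀ i j : Fin 3, i ≠ j → ∀ x y : AloffWallach.CP2,
        IsEmpty (AloffWallach.fibre k l i x ≃ₜ AloffWallach.fibre k l j y)) := by
  have hw := AloffWallach.weight_ne_zero hk hl hkl hgen₂
  have hs := AloffWallach.scales_ne_zero hA hB hC hD
  have key : ∀ (j : Fin 3) (x : AloffWallach.CP2),
      AloffWallach.IsEmbeddedThreefold k l (AloffWallach.fibre k l j x) ∧
      AloffWallach.IsMinimal k l A B C D (AloffWallach.fibre k l j x) ∧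
      AloffWallach.IsAssociative k l A B C D (AloffWallach.fibre k l j x) := fun j x =>
    ⟨AloffWallach.isEmbeddedThreefold_fibre hkl (hw j) x, AloffWallach.isMinimal_fibre hs j x,
      AloffWallach.isAssociative_fibre k l A B C D j x⟩
  exact ⟨key 2, fun j => ⟨AloffWallach.isSpaceFormFamily_fibre hkl (hw j), key j⟩,
    fun i j hij x y => AloffWallach.fibre_ne_fibre (hw i) hij x y,
    fun hinj i j hij x y => AloffWallach.isEmpty_homeomorph_fibre hkl hw (hinj.ne hij) x y⟩
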